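/- Let $k\ge 1$ and $n\ge 3$ be integers with $n\neq 4k$, let $(M^n,g)$ be a smooth pseudo-Riemannian manifold (of any signature, not assumed oriented or orientable), and let $\nabla$ be its Levi-Civita connection. Indices are raised and lowered with $g$, repeated indices are summed, and $[\,\cdots]$ denotes skew symmetrization (normalized to be a projection) over the enclosed indices, those between vertical bars excepted. Let $$R_{ij}{}^k{}_\ell X^\ell=\nabla_i\nabla_jX^k-\nabla_j\nabla_iX^k,\quad R_{ij}=R_{ki}{}^k{}_j,\quad R=R_k{}^k,\quad J=\tfrac{R}{2(n-1)},\quad P_{ij}=\tfrac{1}{n-2}(R_{ij}-Jg_{ij}),$$ and let $$W_{ijkl}=R_{ijkl}-\bigl(P_{ik}g_{jl}-P_{il}g_{jk}+P_{jl}g_{ik}-P_{jk}g_{il}\bigr),\qquad C_{ijk}=\nabla_iP_{jk}-\nabla_jP_{ik}$$ be the Weyl and Cotton tensors. A homogeneous invariant polynomial of degree $k$ is a tensor $\Phi_{s_1\dotsm s_k}^{t_1\dotsm t_k}$ which is a real linear combination of the tensors $\delta_{s_1}^{t_{\tau(1)}}\dotsm\delta_{s_k}^{t_{\tau(k)}}$,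 $\tau\in S_k$, with constant coefficients, and which satisfies $\Phi_{s_{\sigma(1)}\dotsm s_{\sigma(k)}}^{t_{\sigma(1)}\dotsm t_{\sigma(k)}}=\Phi_{s_1\dotsm s_k}^{t_1\dotsm t_k}$ for all $\sigma\in S_k$. Given such a $\Phi$, define $$(\star p_\Phi(W))_{i_1\dotsm i_{2k}}:=\Phi_{s_1\dotsm s_k}^{t_1\dotsm t_k}W_{[i_1i_2|t_1|}{}^{s_1}\dotsm W_{i_{2k-1}i_{2k}]t_k}{}^{s_k},$$ $$(\Phi W^{k-1}C)_{i_2\dotsm i_{2k}}:=\Phi_{s_1\dotsm s_k}^{t_1\dotsm t_k}C_{t_1}{}^{s_1}{}_{[i_2}W_{|t_2|}{}^{s_2}{}_{i_3i_4}\dotsm W_{|t_k|}{}^{s_k}{}_{i_{2k-1}i_{2k}]},$$ $$(\star\rho^\Phi)_{i_2\dotsm i_{2k}}:=(\Phi W^{k-1}C)_{i_2\dotsm i_{2k}}-\frac{1}{n-4k}\nabla^i(\star p_\Phi(W))_{ii_2\dotsm i_{2k}}.$$ Then for every $\Upsilon\in C^\infty(M)$, $$e^{2\Upsilon}(\widehat{\star\rho}^\Phi)_{i_2\dotsm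 i_{2k}}=(\star\rho^\Phi)_{i_2\dotsm i_{2k}}\quad\text{on } M,$$ where $(\widehat{\star\rho}^\Phi)_{i_2\dotsm i_{2k}}$ is defined in the same way from the metric $\widehat g:=e^{2\Upsilon}g$. That is, the $(2k-1)$-form $\star\rho^\Phi$ is conformally invariant of weight $-2$. -/

import Mathlib

open scoped Manifold ContDiff

namespace ConformalForm

/-- A smooth pseudo-Riemannian metric (of arbitrary signature) on an `n`-manifold: a smooth
section of symmetric nondegenerate bilinear forms on the tangent bundle. -/
structure PseudoRiemannianMetric (n : ℕ) (M : Type*) [TopologicalSpace M]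
    [ChartedSpace (EuclideanSpace ℝ (Fin n)) M] [IsManifold (𝓡 n) ∞ M] where
  val : ∀ x : M, TangentSpace (𝓡 n) x →L[ℝ] (TangentSpace (𝓡 n) x →L[ℝ] ℝ)
  symm : ∀ (x : M) (v w : TangentSpace (𝓡 n) x), val x v w = val x w v
  nondegenerate : ∀ (x : M) (v : TangentSpace (𝓡 n) x), (∀ w, val x v w = 0) → v = 0
  contMDiff : ContMDiff (𝓡 n)
    ((𝓡 n).prod 𝓘(ℝ, EuclideanSpace ℝ (Fin n) →L[ℝ] (EuclideanSpace ℝ (Fin n) →L[ℝ] ℝ))) ∞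
    (fun x ↦ Bundle.TotalSpace.mk'
      (EuclideanSpace ℝ (Fin n) →L[ℝ] (EuclideanSpace ℝ (Fin n) →L[ℝ] ℝ))
      (E := fun x : M ↦ TangentSpace (𝓡 n) x →L[ℝ] (TangentSpace (𝓡 n) x →L[ℝ] ℝ)) x (val x))

/-- The conformally related metric `e^{2Υ} g`. -/
noncomputable def PseudoRiemannianMetric.conformal {n : ℕ} {M : Type*} [TopologicalSpace M]
    [ChartedSpace (EuclideanSpace ℝ (Fin n)) M] [IsManifold (𝓡 n) ∞ M]
    (g : PseudoRiemannianMetric n M) (Υ : C^∞⟮𝓡 n, M; 𝓘(ℝ), ℝ⟯) :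
    PseudoRiemannianMetric n M where
  val x := Real.exp (2 * Υ x) • g.val x
  symm x v w := by
    simp only [smul_apply]
    rw [g.symm]
  nondegenerate x v h := by
    refine g.nondegenerate x v fun w ↦ ?_
    have := h w
    simpa [Real.exp_ne_zero] using this
  contMDiff := by
    have h : ContMDiff (𝓡 n) 𝓘(ℝ) ∞ (fun x ↦ Real.exp (2 * Υ x)) :=
      (Real.contDiff_exp.comp (contDiff_const.mul contDiff_id)).contMDiff.comp Υ.contMDiff
    exact h.smul_section g.contMDiff

/-- A homogeneous invariant polynomial of degree `k`, given by its components
`Φ_{s_1 ⋯ s_k}^{t_1 ⋯ t_k}` (first argument `s`, second argument `t`): a real linear combination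
of the tensors `∏ₐ δ_{s_a}^{t_{τ(a)}}`, `τ ∈ S_k` (the identity of `(ℝⁿ)^{⊗k}` composed with the
braiding maps), which is invariant under simultaneous permutation of its lower and upper indices.
Its components are the same in every frame. -/
structure InvariantPolynomial (n k : ℕ) where
  comp : (Fin k → Fin n) → (Fin k → Fin n) → ℝ
  isBraidingCombination : ∃ c : Equiv.Perm (Fin k) → ℝ, ∀ s t : Fin k → Fin n,
    comp s t = ∑ τ : Equiv.Perm (Fin k), c τ * ∏ a : Fin k, if s a = t (τ a) then 1 else 0
  symm : ∀ (σ : Equiv.Perm (Fin k)) (s t : Fin k → Fin n), comp (s ∘ σ) (t ∘ σ) = comp s t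

/-! ### Tensor calculus in a coordinate chart

`G` is the matrix of components `g_{ij}` of a metric, as a function of the coordinates; every
tensor below is given by its components at the point with coordinates `y`. -/

section Coordinates

variable {n : ℕ}

/-- The partial derivative `∂_i f`. -/
noncomputable def pderiv (i : Fin n) (f : EuclideanSpace ℝ (Fin n) → ℝ)
    (y : EuclideanSpace ℝ (Fin n)) : ℝ :=
  fderiv ℝ f y (EuclideanSpace.single i 1)

variable (G : EuclideanSpace ℝ (Fin n) → Matrix (Fin n) (Fin n) ℝ)
  (y : EuclideanSpace ℝ (Fin n))

/-- The Christoffel symbols `Γ^k_{ij}` of the Levi-Civita connection. -/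
noncomputable def christoffel (k i j : Fin n) : ℝ :=
  1 / 2 * ∑ l, (G y)⁻¹ k l *
    (pderiv i (fun z ↦ G z j l) y + pderiv j (fun z ↦ G z i l) y - pderiv l (fun z ↦ G z i j) y)

/-- The covariant derivative `∇_j T_{i_1 ⋯ i_m}` of a covariant tensor field of rank `m`. -/
noncomputable def covDeriv {m : ℕ} (T : EuclideanSpace ℝ (Fin n) → (Fin m → Fin n) → ℝ)
    (j : Fin n) (i : Fin m → Fin n) : ℝ :=
  pderiv j (fun z ↦ T z i) y
    - ∑ a : Fin m, ∑ l, christoffel G y l j (i a) * T y (Function.update i a l)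

/-- The Riemann tensor `R_{ij}{}^k{}_l`, with
`R_{ij}{}^k{}_l X^l = ∇_i ∇_j X^k - ∇_j ∇_i X^k`. -/
noncomputable def riemannUp (i j k l : Fin n) : ℝ :=
  pderiv i (fun z ↦ christoffel G z k j l) y - pderiv j (fun z ↦ christoffel G z k i l) y
    + ∑ m, (christoffel G y k i m * christoffel G y m j l
      - christoffel G y k j m * christoffel G y m i l)

/-- The Riemann tensor `R_{ijkl}`. -/
noncomputable def riemann (i j k l : Fin n) : ℝ :=
  ∑ m, G y k m * riemannUp G y i j m l

/-- The Ricci tensor `R_{ij} = R_{ki}{}^k{}_j`. -/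
noncomputable def ricci (i j : Fin n) : ℝ :=
  ∑ k, riemannUp G y k i k j

/-- The scalar curvature. -/
noncomputable def scalarCurv : ℝ :=
  ∑ i, ∑ j, (G y)⁻¹ i j * ricci G y i j

/-- The Schouten tensor `P_{ij} = (R_{ij} - J g_{ij}) / (n - 2)`, `J = R / (2 (n - 1))`. -/
noncomputable def schouten (i j : Fin n) : ℝ :=
  1 / ((n : ℝ) - 2) * (ricci G y i j - scalarCurv G y / (2 * ((n : ℝ) - 1)) * G y i j)

/-- The Weyl tensor `W_{ijkl}`. -/
noncomputable def weyl (i j k l : Fin n) : ℝ :=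
  riemann G y i j k l - (schouten G y i k * G y j l - schouten G y i l * G y j k
    + schouten G y j l * G y i k - schouten G y j k * G y i l)

/-- The Cotton tensor `C_{ijk} = ∇_i P_{jk} - ∇_j P_{ik}`. -/
noncomputable def cotton (i j k : Fin n) : ℝ :=
  covDeriv G y (fun z (I : Fin 2 → Fin n) ↦ schouten G z (I 0) (I 1)) i ![j, k]
    - covDeriv G y (fun z (I : Fin 2 → Fin n) ↦ schouten G z (I 0) (I 1)) j ![i, k]

/-- `W_{ijt}{}^s`. -/
noncomputable def weylRaise4 (i j t s : Fin n) : ℝ :=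
  ∑ u, (G y)⁻¹ s u * weyl G y i j t u

/-- `W_t{}^s{}_{ij}`. -/
noncomputable def weylRaise2 (t s i j : Fin n) : ℝ :=
  ∑ u, (G y)⁻¹ s u * weyl G y t u i j

/-- `C_t{}^s{}_i`. -/
noncomputable def cottonRaise2 (t s i : Fin n) : ℝ :=
  ∑ u, (G y)⁻¹ s u * cotton G y t u i

/-- Skew symmetrization `T_{[i_1 ⋯ i_m]}`, normalized to be a projection. -/
noncomputable def skew {m : ℕ} (T : (Fin m → Fin n) → ℝ) (i : Fin m → Fin n) : ℝ :=
  1 / (m.factorial : ℝ) *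
    ∑ σ : Equiv.Perm (Fin m), ((Equiv.Perm.sign σ : ℤ) : ℝ) * T (i ∘ σ)

/-- The index tuple `(i, i_2, …, i_{2k})`, where `I = (i_2, …, i_{2k})`. -/
def consIndex {k : ℕ} (i : Fin n) (I : Fin (2 * k - 1) → Fin n) : Fin (2 * k) → Fin n :=
  fun a ↦ if h : (a : ℕ) = 0 then i else I ⟨(a : ℕ) - 1, by omega⟩

variable {k : ℕ} (Φ : InvariantPolynomial n k)

/-- The `2k`-form
`(⋆p_Φ(W))_{i_1 ⋯ i_{2k}} = Φ_{s_1 ⋯ s_k}^{t_1 ⋯ t_k} W_{[i_1 i_2 |t_1|}{}^{s_1} ⋯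
W_{i_{2k-1} i_{2k}] t_k}{}^{s_k}`; the index `i_b` is `i (b - 1)`. -/
noncomputable def starP (i : Fin (2 * k) → Fin n) : ℝ :=
  skew (fun i : Fin (2 * k) → Fin n ↦
    ∑ s : Fin k → Fin n, ∑ t : Fin k → Fin n, Φ.comp s t *
      ∏ a : Fin k, weylRaise4 G y (i ⟨2 * (a : ℕ), by omega⟩) (i ⟨2 * (a : ℕ) + 1, by omega⟩)
        (t a) (s a)) i

/-- The `(2k-1)`-form
`(ΦW^{k-1}C)_{i_2 ⋯ i_{2k}} = Φ_{s_1 ⋯ s_k}^{t_1 ⋯ t_k} C_{t_1}{}^{s_1}{}_{[i_2}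
W_{|t_2|}{}^{s_2}{}_{i_3 i_4} ⋯ W_{|t_k|}{}^{s_k}{}_{i_{2k-1} i_{2k}]}`;
the index `i_b` is `i (b - 2)`. -/
noncomputable def phiWC (i : Fin (2 * k - 1) → Fin n) : ℝ :=
  skew (fun i : Fin (2 * k - 1) → Fin n ↦
    ∑ s : Fin k → Fin n, ∑ t : Fin k → Fin n, Φ.comp s t *
      ∏ a : Fin k,
        if (a : ℕ) = 0 then cottonRaise2 G y (t a) (s a) (i ⟨0, by have := a.isLt; omega⟩)
        else weylRaise2 G y (t a) (s a)
          (i ⟨2 * (a : ℕ) - 1, by omega⟩) (i ⟨2 * (a : ℕ), by omega⟩)) i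

/-- The `(2k-1)`-form `(⋆ρ^Φ)_{i_2 ⋯ i_{2k}} = (ΦW^{k-1}C)_{i_2 ⋯ i_{2k}}
- (n - 4k)^{-1} ∇^i (⋆p_Φ(W))_{i i_2 ⋯ i_{2k}}`. -/
noncomputable def starRho (I : Fin (2 * k - 1) → Fin n) : ℝ :=
  phiWC G y Φ I - 1 / ((n : ℝ) - 4 * (k : ℝ)) *
    ∑ i, ∑ j, (G y)⁻¹ i j * covDeriv G y (fun z ↦ starP G z Φ) j (consIndex i I)

end Coordinates

/-- The components `g_{ij} = g(∂_i, ∂_j)` of a metric in the chart `φ`, as functions of the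
coordinates. -/
noncomputable def PseudoRiemannianMetric.inChart {n : ℕ} {M : Type*} [TopologicalSpace M]
    [ChartedSpace (EuclideanSpace ℝ (Fin n)) M] [IsManifold (𝓡 n) ∞ M]
    (g : PseudoRiemannianMetric n M) (φ : OpenPartialHomeomorph M (EuclideanSpace ℝ (Fin n)))
    (y : EuclideanSpace ℝ (Fin n)) : Matrix (Fin n) (Fin n) ℝ :=
  Matrix.of fun i j ↦ g.val (φ.symm y)
    (mfderiv (𝓡 n) (𝓡 n) φ.symm y (EuclideanSpace.single i (1 : ℝ)))
    (mfderiv (𝓡 n) (𝓡 n) φ.symm y (EuclideanSpace.single j (1 : ℝ)))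

end ConformalForm

/-! Write `u` for the conformal factor in a chart, `u_i` for its derivatives and `u^i` for its
gradient. All tensors are given by components, so it suffices to work in one chart with a smooth
nondegenerate symmetric matrix `G`. Passing from `G` to `e^{2u} G` adds to the Christoffel symbols
the tensor `S^k_{ij} = δ^k_i u_j + δ^k_j u_i - g_{ij} u^k`. Expanding the curvature shows that the
Schouten tensor changes by `-A`, where `A_{ij} = ∇_i u_j - u_i u_j + |∇u|² g_{ij} / 2`, and that the
change of the Riemann tensor is exactly absorbed by this. Hence `W_{ijt}{}^s` is invariant
(`weylRaise4_rescale`), and so is the `2k`-form `⋆p_Φ(W)`. Skew symmetrizing `∇_i A_{jk}` in `i, j`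
leaves the Ricci identity for `du` and lower order terms, which combine to `Ĉ_{ijk} = C_{ijk} + u^l
W_{ijlk}` (`cotton_rescale`).

Two changes proportional to the interior product of `∇u` with `⋆p_Φ(W)` then cancel. The Cotton
term, multiplied by `e^{2u}`, gains it with coefficient `1` (`phiWC_rescale`). The divergence of a
fixed `q`-form, multiplied by `e^{2u}`, gains the interior product with coefficient `n - 2q`
(`divergence_rescale`); for `q = 2k` this is `n - 4k`, which the factor `1 / (n - 4k)` normalizes to
`1`.

The combinatorial point is that the Cotton term is skew only over `2k - 1` indices, with `u^l`
contracted into a fixed slot, while `⋆p_Φ(W)` is skew over all `2k`. The two agree because any slot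
can be moved to the first one by a signed symmetry of the unskewed tensor (`skew_cons`,
`exists_isSignInvariant_phiTensor`). These symmetries come from `W_{ijt}{}^s = -W_{jit}{}^s` and the
simultaneous permutation symmetry of `Φ`. -/

namespace ConformalForm

/-! ### Calculus of coordinate partial derivatives -/

section PartialDerivatives

variable {n : ℕ} {f f' : EuclideanSpace ℝ (Fin n) → ℝ} {y : EuclideanSpace ℝ (Fin n)}
  {U : Set (EuclideanSpace ℝ (Fin n))}

theorem pderiv_congr (hU : IsOpen U) (hy : y ∈ U) (h : ∀ z ∈ U, f z = f' z) (i : Fin n) :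
    pderiv i f y = pderiv i f' y := by
  have : f =ᶠ[nhds y] f' := Filter.eventuallyEq_of_mem (hU.mem_nhds hy) h
  simp only [pderiv, this.fderiv_eq]

theorem pderiv_const (i : Fin n) (c : ℝ) : pderiv i (fun _ ↦ c) y = 0 := by
  simp [pderiv]

theorem pderiv_add (hf : DifferentiableAt ℝ f y) (hf' : DifferentiableAt ℝ f' y) (i : Fin n) :
    pderiv i (fun z ↦ f z + f' z) y = pderiv i f y + pderiv i f' y := by
  simp only [pderiv, fderiv_fun_add hf hf', add_apply]

theorem pderiv_sub (hf : DifferentiableAt ℝ f y) (hf' : DifferentiableAt ℝ f' y) (i : Fin n) :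
    pderiv i (fun z ↦ f z - f' z) y = pderiv i f y - pderiv i f' y := by
  simp only [pderiv, fderiv_fun_sub hf hf', sub_apply]

theorem pderiv_mul (hf : DifferentiableAt ℝ f y) (hf' : DifferentiableAt ℝ f' y) (i : Fin n) :
    pderiv i (fun z ↦ f z * f' z) y = pderiv i f y * f' y + f y * pderiv i f' y := by
  simp only [pderiv, fderiv_fun_mul hf hf', add_apply, smul_apply, smul_eq_mul]
  ring

theorem pderiv_sum {ι : Type*} {s : Finset ι} {F : ι → EuclideanSpace ℝ (Fin n) → ℝ}
    (hF : ∀ a ∈ s, DifferentiableAt ℝ (F a) y) (i : Fin n) :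
    pderiv i (fun z ↦ ∑ a ∈ s, F a z) y = ∑ a ∈ s, pderiv i (F a) y := by
  simp only [pderiv, fderiv_fun_sum hF, sum_apply]

theorem pderiv_const_mul (c : ℝ) (hf : DifferentiableAt ℝ f y) (i : Fin n) :
    pderiv i (fun z ↦ c * f z) y = c * pderiv i f y := by
  rw [pderiv_mul (differentiableAt_const c) hf, pderiv_const]
  ring

theorem pderiv_exp_two_mul (hf : DifferentiableAt ℝ f y) (i : Fin n) :
    pderiv i (fun z ↦ Real.exp (2 * f z)) y = Real.exp (2 * f y) * (2 * pderiv i f y) := by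
  simp only [pderiv]
  rw [fderiv_exp (hf.const_mul 2), fderiv_const_mul hf]
  simp

theorem contDiffOn_pderiv (hU : IsOpen U) (hf : ContDiffOn ℝ ∞ f U) (i : Fin n) :
    ContDiffOn ℝ ∞ (pderiv i f) U :=
  (hf.fderiv_of_isOpen hU (m := ∞) (by simp)).clm_apply contDiffOn_const

theorem pderiv_comm (hU : IsOpen U) (hf : ContDiffOn ℝ ∞ f U) (hy : y ∈ U) (i j : Fin n) :
    pderiv i (pderiv j f) y = pderiv j (pderiv i f) y := by
  have hfy : ContDiffAt ℝ ∞ f y := hf.contDiffAt (hU.mem_nhds hy)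
  have hd : DifferentiableAt ℝ (fderiv ℝ f) y :=
    (hfy.fderiv_right (m := 1) (by norm_cast)).differentiableAt (by simp)
  have hs := hfy.isSymmSndFDerivAt (by simpa using WithTop.coe_le_coe.2 (le_top : (2 : ℕ∞) ≤ ⊤))
  have key : ∀ a b : Fin n, pderiv a (pderiv b f) y =
      fderiv ℝ (fderiv ℝ f) y (EuclideanSpace.single a 1) (EuclideanSpace.single b 1) := by
    intro a b
    change fderiv ℝ (fun z ↦ fderiv ℝ f z (EuclideanSpace.single b 1)) y _ = _
    rw [fderiv_clm_apply hd (differentiableAt_const _)]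
    simp
  rw [key, key]
  exact hs.eq _ _

theorem ContDiffOn.differentiableAt_of_isOpen (hU : IsOpen U) (hf : ContDiffOn ℝ ∞ f U)
    (hy : y ∈ U) : DifferentiableAt ℝ f y :=
  (hf.contDiffAt (hU.mem_nhds hy)).differentiableAt (by simp)

end PartialDerivatives

/-! ### Smoothness of the inverse matrix -/

section Inverse

theorem contDiffOn_det {E : Type*} [NormedAddCommGroup E] [NormedSpace ℝ E] {n : ℕ} {U : Set E}
    {A : E → Matrix (Fin n) (Fin n) ℝ} (hA : ∀ i j, ContDiffOn ℝ ∞ (fun z ↦ A z i j) U) :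
    ContDiffOn ℝ ∞ (fun z ↦ (A z).det) U := by
  simp only [Matrix.det_apply']
  exact ContDiffOn.sum fun σ _ ↦ contDiffOn_const.mul (contDiffOn_prod fun i _ ↦ hA _ _)

/-- Cramer's rule: each entry is a quotient of two determinants, hence of polynomials in the entries
of `A`. -/
theorem contDiffOn_inv_apply {E : Type*} [NormedAddCommGroup E] [NormedSpace ℝ E] {n : ℕ}
    {U : Set E} {A : E → Matrix (Fin n) (Fin n) ℝ}
    (hA : ∀ i j, ContDiffOn ℝ ∞ (fun z ↦ A z i j) U) (hdet : ∀ z ∈ U, (A z).det ≠ 0)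
    (i j : Fin n) : ContDiffOn ℝ ∞ (fun z ↦ (A z)⁻¹ i j) U := by
  simp only [Matrix.inv_def, Ring.inverse_eq_inv', Matrix.smul_apply, smul_eq_mul,
    Matrix.adjugate_apply]
  refine ((contDiffOn_det hA).inv hdet).mul (contDiffOn_det fun a b ↦ ?_)
  simp only [Matrix.updateRow_apply]
  split_ifs
  · exact contDiffOn_const
  · exact hA _ _

end Inverse

/-! ### Index gymnastics, Christoffel symbols and their conformal change -/

section Metric

variable {n : ℕ}

/-- `G` is the smooth matrix of components of a pseudo-Riemannian metric on the open set `U`. -/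
structure IsMetricOn (G : EuclideanSpace ℝ (Fin n) → Matrix (Fin n) (Fin n) ℝ)
    (U : Set (EuclideanSpace ℝ (Fin n))) : Prop where
  isOpen : IsOpen U
  contDiffOn : ∀ i j, ContDiffOn ℝ ∞ (fun z ↦ G z i j) U
  symm : ∀ z ∈ U, ∀ i j, G z i j = G z j i
  det_ne_zero : ∀ z ∈ U, (G z).det ≠ 0

/-- The components of the metric `e^{2u} g`. -/
noncomputable def rescale (u : EuclideanSpace ℝ (Fin n) → ℝ)
    (G : EuclideanSpace ℝ (Fin n) → Matrix (Fin n) (Fin n) ℝ) :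
    EuclideanSpace ℝ (Fin n) → Matrix (Fin n) (Fin n) ℝ :=
  fun z ↦ Real.exp (2 * u z) • G z

/-- The vector `v^k = g^{kl} v_l`. -/
noncomputable def raise (G : EuclideanSpace ℝ (Fin n) → Matrix (Fin n) (Fin n) ℝ)
    (y : EuclideanSpace ℝ (Fin n)) (v : Fin n → ℝ) (k : Fin n) : ℝ :=
  ∑ l, (G y)⁻¹ k l * v l

/-- The gradient `∇^k u`. -/
noncomputable def gradUp (G : EuclideanSpace ℝ (Fin n) → Matrix (Fin n) (Fin n) ℝ)
    (u : EuclideanSpace ℝ (Fin n) → ℝ) (y : EuclideanSpace ℝ (Fin n)) (k : Fin n) : ℝ :=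
  raise G y (fun l ↦ pderiv l u y) k

/-- The Hessian `∇_i ∇_j u`. -/
noncomputable def hess (G : EuclideanSpace ℝ (Fin n) → Matrix (Fin n) (Fin n) ℝ)
    (u : EuclideanSpace ℝ (Fin n) → ℝ) (y : EuclideanSpace ℝ (Fin n)) (i j : Fin n) : ℝ :=
  pderiv i (pderiv j u) y - ∑ m, christoffel G y m i j * pderiv m u y

/-- The difference `δ^k_i u_j + δ^k_j u_i - g_{ij} u^k` of the Christoffel symbols of `e^{2u} g`
and of `g`. -/
noncomputable def christoffelShift (G : EuclideanSpace ℝ (Fin n) → Matrix (Fin n) (Fin n) ℝ)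
    (u : EuclideanSpace ℝ (Fin n) → ℝ) (y : EuclideanSpace ℝ (Fin n)) (k i j : Fin n) : ℝ :=
  (if k = i then 1 else 0) * pderiv j u y + (if k = j then 1 else 0) * pderiv i u y
    - G y i j * gradUp G u y k

variable {G : EuclideanSpace ℝ (Fin n) → Matrix (Fin n) (Fin n) ℝ}
  {U : Set (EuclideanSpace ℝ (Fin n))} {y : EuclideanSpace ℝ (Fin n)}
  {u : EuclideanSpace ℝ (Fin n) → ℝ}

namespace IsMetricOn

variable (hG : IsMetricOn G U) (hy : y ∈ U)
include hG hy

theorem differentiableAt (i j : Fin n) : DifferentiableAt ℝ (fun z ↦ G z i j) y :=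
  ContDiffOn.differentiableAt_of_isOpen hG.isOpen (hG.contDiffOn i j) hy

theorem sum_mul_inv (i k : Fin n) :
    ∑ j, G y i j * (G y)⁻¹ j k = if i = k then 1 else 0 := by
  have := Matrix.mul_nonsing_inv (G y) (isUnit_iff_ne_zero.2 (hG.det_ne_zero y hy))
  simpa [Matrix.mul_apply, Matrix.one_apply] using congrFun (congrFun this i) k

theorem sum_inv_mul (i k : Fin n) :
    ∑ j, (G y)⁻¹ i j * G y j k = if i = k then 1 else 0 := by
  have := Matrix.nonsing_inv_mul (G y) (isUnit_iff_ne_zero.2 (hG.det_ne_zero y hy))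
  simpa [Matrix.mul_apply, Matrix.one_apply] using congrFun (congrFun this i) k

theorem inv_symm (i j : Fin n) : (G y)⁻¹ i j = (G y)⁻¹ j i := by
  have h : (G y).transpose = G y := by
    ext a b
    exact hG.symm y hy b a
  have := Matrix.transpose_nonsing_inv (G y)
  rw [h] at this
  exact (congrFun (congrFun this j) i)

theorem lower_raise (v : Fin n → ℝ) (j : Fin n) : ∑ k, G y j k * raise G y v k = v j := by
  simp only [raise, Finset.mul_sum, ← mul_assoc]
  rw [Finset.sum_comm]
  simp only [← Finset.sum_mul, hG.sum_mul_inv hy]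
  simp

theorem raise_lower (w : Fin n → ℝ) (k : Fin n) :
    raise G y (fun j ↦ ∑ m, G y j m * w m) k = w k := by
  simp only [raise, Finset.mul_sum, ← mul_assoc]
  rw [Finset.sum_comm]
  simp only [← Finset.sum_mul, hG.sum_inv_mul hy]
  simp

theorem raise_metric (i k : Fin n) :
    raise G y (fun l ↦ G y i l) k = if k = i then 1 else 0 := by
  simp only [raise, hG.symm y hy i, hG.sum_inv_mul hy]

theorem sum_raise_mul (v w : Fin n → ℝ) :
    ∑ k, raise G y v k * w k = ∑ k, v k * raise G y w k := by
  simp only [raise, Finset.mul_sum, Finset.sum_mul]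
  rw [Finset.sum_comm]
  refine Finset.sum_congr rfl fun a _ ↦ Finset.sum_congr rfl fun b _ ↦ ?_
  rw [hG.inv_symm hy b a]
  ring

theorem christoffel_symm (k i j : Fin n) : christoffel G y k i j = christoffel G y k j i := by
  simp only [christoffel]
  congr 1
  refine Finset.sum_congr rfl fun l _ ↦ ?_
  rw [pderiv_congr hG.isOpen hy (fun z hz ↦ hG.symm z hz i j)]
  ring

omit hG hy in
theorem christoffel_eq_raise (k i j : Fin n) : christoffel G y k i j =
    raise G y (fun l ↦ 1 / 2 * (pderiv i (fun z ↦ G z j l) y + pderiv j (fun z ↦ G z i l) y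
      - pderiv l (fun z ↦ G z i j) y)) k := by
  simp only [christoffel, raise, Finset.mul_sum]
  exact Finset.sum_congr rfl fun l _ ↦ by ring

theorem lower_christoffel (k i j : Fin n) : ∑ m, G y k m * christoffel G y m i j =
    1 / 2 * (pderiv i (fun z ↦ G z j k) y + pderiv j (fun z ↦ G z i k) y
      - pderiv k (fun z ↦ G z i j) y) := by
  simp only [christoffel_eq_raise]
  rw [hG.lower_raise hy]

/-- The metric is parallel. -/
theorem pderiv_metric (i k l : Fin n) : pderiv i (fun z ↦ G z k l) y =
    ∑ m, G y k m * christoffel G y m i l + ∑ m, G y l m * christoffel G y m i k := by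
  rw [hG.lower_christoffel hy, hG.lower_christoffel hy,
    pderiv_congr hG.isOpen hy (fun z hz ↦ hG.symm z hz l k),
    pderiv_congr (i := l) hG.isOpen hy (fun z hz ↦ hG.symm z hz i k),
    pderiv_congr (i := k) hG.isOpen hy (fun z hz ↦ hG.symm z hz i l)]
  ring

theorem rescale_inv : (rescale u G y)⁻¹ = Real.exp (-(2 * u y)) • (G y)⁻¹ := by
  refine Matrix.inv_eq_left_inv ?_
  rw [rescale, Matrix.smul_mul, Matrix.mul_smul, smul_smul, ← Real.exp_add,
    Matrix.nonsing_inv_mul _ (isUnit_iff_ne_zero.2 (hG.det_ne_zero y hy))]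
  simp

theorem pderiv_rescale (hu : DifferentiableAt ℝ u y) (i j k : Fin n) :
    pderiv i (fun z ↦ rescale u G z j k) y =
      Real.exp (2 * u y) * (pderiv i (fun z ↦ G z j k) y + 2 * pderiv i u y * G y j k) := by
  simp only [rescale, Matrix.smul_apply, smul_eq_mul]
  rw [pderiv_mul (hu.const_mul 2).exp (hG.differentiableAt hy j k), pderiv_exp_two_mul hu]
  ring

/-- The factor `e^{2u}` of the differentiated metric cancels the `e^{-2u}` of its inverse; what is
left over comes from differentiating the exponential. -/
theorem christoffel_rescale (hu : DifferentiableAt ℝ u y) (k i j : Fin n) :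
    christoffel (rescale u G) y k i j =
      christoffel G y k i j + christoffelShift G u y k i j := by
  have hexp : Real.exp (-(2 * u y)) * Real.exp (2 * u y) = 1 := by rw [← Real.exp_add]; simp
  simp only [christoffel, hG.pderiv_rescale hy hu, hG.rescale_inv hy, Matrix.smul_apply,
    smul_eq_mul]
  have h : ∀ l, Real.exp (-(2 * u y)) * (G y)⁻¹ k l *
      (Real.exp (2 * u y) * (pderiv i (fun z ↦ G z j l) y + 2 * pderiv i u y * G y j l)
      + Real.exp (2 * u y) * (pderiv j (fun z ↦ G z i l) y + 2 * pderiv j u y * G y i l)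
      - Real.exp (2 * u y) * (pderiv l (fun z ↦ G z i j) y + 2 * pderiv l u y * G y i j)) =
      (G y)⁻¹ k l * (pderiv i (fun z ↦ G z j l) y + pderiv j (fun z ↦ G z i l) y
        - pderiv l (fun z ↦ G z i j) y)
      + 2 * (pderiv i u y * ((G y)⁻¹ k l * G y j l) + pderiv j u y * ((G y)⁻¹ k l * G y i l)
        - G y i j * ((G y)⁻¹ k l * pderiv l u y)) := fun l ↦ by
    linear_combination ((G y)⁻¹ k l *
      ((pderiv i (fun z ↦ G z j l) y + 2 * pderiv i u y * G y j l)
      + (pderiv j (fun z ↦ G z i l) y + 2 * pderiv j u y * G y i l)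
      - (pderiv l (fun z ↦ G z i j) y + 2 * pderiv l u y * G y i j))) * hexp
  have hj := hG.raise_metric hy j k
  have hi := hG.raise_metric hy i k
  simp only [raise] at hi hj
  simp only [h, Finset.sum_add_distrib, Finset.sum_sub_distrib, ← Finset.mul_sum, hi, hj,
    christoffelShift, gradUp, raise]
  ring

omit hG hy in
theorem sum_mul_christoffelShift (f : Fin n → ℝ) (i j : Fin n) :
    ∑ m, f m * christoffelShift G u y m i j =
      f i * pderiv j u y + f j * pderiv i u y - G y i j * ∑ m, f m * gradUp G u y m := by
  simp only [christoffelShift, mul_sub, mul_add, Finset.sum_sub_distrib, Finset.sum_add_distrib,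
    ite_mul, one_mul, zero_mul, mul_ite, mul_zero, Finset.sum_ite_eq', Finset.mem_univ, if_true,
    Finset.mul_sum]
  congr 1
  exact Finset.sum_congr rfl fun m _ ↦ by ring

omit hG hy in
theorem sum_christoffelShift_mul (f : Fin n → ℝ) (k i : Fin n) :
    ∑ m, christoffelShift G u y k i m * f m =
      (if k = i then 1 else 0) * ∑ m, pderiv m u y * f m + f k * pderiv i u y
        - (∑ m, G y i m * f m) * gradUp G u y k := by
  simp only [christoffelShift, sub_mul, add_mul, Finset.sum_sub_distrib, Finset.sum_add_distrib,
    ite_mul, one_mul, zero_mul, Finset.sum_ite_eq, Finset.mem_univ, if_true, Finset.sum_mul]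
  congr 1
  · congr 1
    · split_ifs <;> simp
    · ring
  · exact Finset.sum_congr rfl fun m _ ↦ by ring

theorem lower_gradUp (j : Fin n) : ∑ k, G y j k * gradUp G u y k = pderiv j u y :=
  hG.lower_raise hy _ _

omit hy in
theorem contDiffOn_gradUp (hu : ContDiffOn ℝ ∞ u U) (k : Fin n) :
    ContDiffOn ℝ ∞ (fun z ↦ gradUp G u z k) U := by
  simp only [gradUp, raise]
  exact ContDiffOn.sum fun l _ ↦ (contDiffOn_inv_apply hG.contDiffOn hG.det_ne_zero k l).mul
    (contDiffOn_pderiv hG.isOpen hu l)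

omit hy in
theorem contDiffOn_christoffel (k i j : Fin n) :
    ContDiffOn ℝ ∞ (fun z ↦ christoffel G z k i j) U := by
  simp only [christoffel]
  refine contDiffOn_const.mul (ContDiffOn.sum fun l _ ↦
    (contDiffOn_inv_apply hG.contDiffOn hG.det_ne_zero k l).mul ?_)
  exact ((contDiffOn_pderiv hG.isOpen (hG.contDiffOn _ _) _).add
    (contDiffOn_pderiv hG.isOpen (hG.contDiffOn _ _) _)).sub
    (contDiffOn_pderiv hG.isOpen (hG.contDiffOn _ _) _)

omit hy in
theorem contDiffOn_hess (hu : ContDiffOn ℝ ∞ u U) (i j : Fin n) :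
    ContDiffOn ℝ ∞ (fun z ↦ hess G u z i j) U := by
  simp only [hess]
  exact (contDiffOn_pderiv hG.isOpen (contDiffOn_pderiv hG.isOpen hu j) i).sub
    (ContDiffOn.sum fun m _ ↦ (hG.contDiffOn_christoffel m i j).mul
      (contDiffOn_pderiv hG.isOpen hu m))

theorem hess_symm (hu : ContDiffOn ℝ ∞ u U) (i j : Fin n) :
    hess G u y i j = hess G u y j i := by
  simp only [hess, hG.christoffel_symm hy _ i j, pderiv_comm hG.isOpen hu hy i j]

/-- Raising an index commutes with `∇`. To avoid differentiating the inverse matrix, the identity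
`g_{jm} u^m = u_j` is differentiated, `∂g` is replaced by Christoffel symbols, and the index is
raised at the end. -/
theorem pderiv_gradUp (hu : ContDiffOn ℝ ∞ u U) (i k : Fin n) :
    pderiv i (fun z ↦ gradUp G u z k) y =
      raise G y (hess G u y i) k - ∑ m, christoffel G y k i m * gradUp G u y m := by
  have hd : ∀ m, DifferentiableAt ℝ (fun z ↦ gradUp G u z m) y := fun m ↦
    ContDiffOn.differentiableAt_of_isOpen hG.isOpen (hG.contDiffOn_gradUp hu m) hy
  have key : ∀ j, ∑ m, G y j m * pderiv i (fun z ↦ gradUp G u z m) y =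
      hess G u y i j - ∑ m, G y j m * ∑ l, christoffel G y m i l * gradUp G u y l := by
    intro j
    have h1 := pderiv_congr hG.isOpen hy (fun z hz ↦ hG.lower_gradUp (u := u) hz j) i
    rw [pderiv_sum (F := fun m z ↦ G z j m * gradUp G u z m)
      fun m _ ↦ (hG.differentiableAt hy j m).mul (hd m)] at h1
    simp only [pderiv_mul (hG.differentiableAt hy j _) (hd _), Finset.sum_add_distrib] at h1
    change _ = pderiv i (pderiv j u) y at h1
    have h2 : ∑ m, pderiv i (fun z ↦ G z j m) y * gradUp G u y m =
        ∑ m, G y j m * ∑ l, christoffel G y m i l * gradUp G u y l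
        + ∑ m, christoffel G y m i j * pderiv m u y := by
      simp only [hG.pderiv_metric hy, add_mul, Finset.sum_add_distrib]
      congr 1
      · simp only [Finset.mul_sum, Finset.sum_mul]
        rw [Finset.sum_comm]
        exact Finset.sum_congr rfl fun m _ ↦ Finset.sum_congr rfl fun l _ ↦ by ring
      · simp only [← hG.lower_gradUp hy, Finset.mul_sum, Finset.sum_mul]
        rw [Finset.sum_comm]
        refine Finset.sum_congr rfl fun m _ ↦ Finset.sum_congr rfl fun l _ ↦ ?_
        rw [hG.symm y hy l m]
        ring
    rw [hess]
    linarith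
  have h3 := hG.raise_lower hy (fun m ↦ pderiv i (fun z ↦ gradUp G u z m) y) k
  have h4 := hG.raise_lower hy (fun m ↦ ∑ l, christoffel G y m i l * gradUp G u y l) k
  rw [← h3, ← h4]
  simp only [key]
  simp only [raise, mul_sub, Finset.sum_sub_distrib]

end IsMetricOn

end Metric

/-! ### Symmetries of the curvature and its conformal change -/

section Curvature

variable {n : ℕ}

/-- The squared norm `|∇u|²`. -/
noncomputable def gradSq (G : EuclideanSpace ℝ (Fin n) → Matrix (Fin n) (Fin n) ℝ)
    (u : EuclideanSpace ℝ (Fin n) → ℝ) (y : EuclideanSpace ℝ (Fin n)) : ℝ :=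
  ∑ m, pderiv m u y * gradUp G u y m

/-- The difference `∇_i u_j - u_i u_j + |∇u|² g_{ij} / 2` of the Schouten tensors of `g` and of
`e^{2u} g`. -/
noncomputable def schoutenShift (G : EuclideanSpace ℝ (Fin n) → Matrix (Fin n) (Fin n) ℝ)
    (u : EuclideanSpace ℝ (Fin n) → ℝ) (y : EuclideanSpace ℝ (Fin n)) (i j : Fin n) : ℝ :=
  hess G u y i j - pderiv i u y * pderiv j u y + 1 / 2 * gradSq G u y * G y i j

variable {G : EuclideanSpace ℝ (Fin n) → Matrix (Fin n) (Fin n) ℝ}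
  {U : Set (EuclideanSpace ℝ (Fin n))} {y : EuclideanSpace ℝ (Fin n)}
  {u : EuclideanSpace ℝ (Fin n) → ℝ}

theorem riemannUp_antisymm (i j k l : Fin n) :
    riemannUp G y i j k l = -riemannUp G y j i k l := by
  simp only [riemannUp, Finset.sum_sub_distrib]
  ring

theorem riemann_antisymm (i j k l : Fin n) : riemann G y i j k l = -riemann G y j i k l := by
  simp only [riemann, ← Finset.sum_neg_distrib]
  exact Finset.sum_congr rfl fun m _ ↦ by rw [riemannUp_antisymm]; ring

theorem weyl_antisymm (i j k l : Fin n) : weyl G y i j k l = -weyl G y j i k l := by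
  rw [weyl, weyl, riemann_antisymm]
  ring

namespace IsMetricOn

variable (hG : IsMetricOn G U) (hy : y ∈ U)
include hG

theorem contDiffOn_riemannUp (i j k l : Fin n) :
    ContDiffOn ℝ ∞ (fun z ↦ riemannUp G z i j k l) U := by
  have h := fun a b c ↦ hG.contDiffOn_christoffel a b c
  simp only [riemannUp]
  exact ((contDiffOn_pderiv hG.isOpen (h _ _ _) _).sub
    (contDiffOn_pderiv hG.isOpen (h _ _ _) _)).add (ContDiffOn.sum fun m _ ↦
      ((h _ _ _).mul (h _ _ _)).sub ((h _ _ _).mul (h _ _ _)))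

theorem contDiffOn_schouten (i j : Fin n) : ContDiffOn ℝ ∞ (fun z ↦ schouten G z i j) U := by
  have h : ∀ a b, ContDiffOn ℝ ∞ (fun z ↦ ricci G z a b) U := fun a b ↦ by
    simp only [ricci]
    exact ContDiffOn.sum fun k _ ↦ hG.contDiffOn_riemannUp _ _ _ _
  have hs : ContDiffOn ℝ ∞ (fun z ↦ scalarCurv G z) U := by
    simp only [scalarCurv]
    exact ContDiffOn.sum fun a _ ↦ ContDiffOn.sum fun b _ ↦
      (contDiffOn_inv_apply hG.contDiffOn hG.det_ne_zero a b).mul (h a b)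
  simp only [schouten]
  exact contDiffOn_const.mul ((h i j).sub ((hs.div_const _).mul (hG.contDiffOn i j)))

theorem contDiffOn_gradSq (hu : ContDiffOn ℝ ∞ u U) : ContDiffOn ℝ ∞ (gradSq G u) U :=
  ContDiffOn.sum fun m _ ↦ (contDiffOn_pderiv hG.isOpen hu m).mul (hG.contDiffOn_gradUp hu m)

theorem contDiffOn_schoutenShift (hu : ContDiffOn ℝ ∞ u U) (i j : Fin n) :
    ContDiffOn ℝ ∞ (fun z ↦ schoutenShift G u z i j) U := by
  simp only [schoutenShift]
  exact ((hG.contDiffOn_hess hu i j).sub ((contDiffOn_pderiv hG.isOpen hu i).mul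
    (contDiffOn_pderiv hG.isOpen hu j))).add
    ((contDiffOn_const.mul (hG.contDiffOn_gradSq hu)).mul (hG.contDiffOn i j))

include hy

theorem differentiableAt_pderiv {f : EuclideanSpace ℝ (Fin n) → ℝ} (hf : ContDiffOn ℝ ∞ f U)
    (i : Fin n) : DifferentiableAt ℝ (pderiv i f) y :=
  ContDiffOn.differentiableAt_of_isOpen hG.isOpen (contDiffOn_pderiv hG.isOpen hf i) hy

theorem differentiableAt_christoffel (k i j : Fin n) :
    DifferentiableAt ℝ (fun z ↦ christoffel G z k i j) y :=
  ContDiffOn.differentiableAt_of_isOpen hG.isOpen (hG.contDiffOn_christoffel k i j) hy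

theorem differentiableAt_gradUp (hu : ContDiffOn ℝ ∞ u U) (k : Fin n) :
    DifferentiableAt ℝ (fun z ↦ gradUp G u z k) y :=
  ContDiffOn.differentiableAt_of_isOpen hG.isOpen (hG.contDiffOn_gradUp hu k) hy

/-- Obtained by differentiating the formula for the Christoffel symbols of the first kind; the last
two sums are the `∂g` terms of the product rule. -/
theorem lower_pderiv_christoffel (i j k l : Fin n) :
    ∑ m, G y k m * pderiv i (fun z ↦ christoffel G z m j l) y =
      1 / 2 * (pderiv i (pderiv j (fun z ↦ G z l k)) y + pderiv i (pderiv l (fun z ↦ G z j k)) y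
        - pderiv i (pderiv k (fun z ↦ G z j l)) y)
      - ∑ m, (∑ p, G y k p * christoffel G y p i m) * christoffel G y m j l
      - ∑ m, (∑ p, G y m p * christoffel G y p i k) * christoffel G y m j l := by
  have hd := fun a b c ↦ hG.differentiableAt_pderiv hy (hG.contDiffOn a b) c
  have h1 := pderiv_congr hG.isOpen hy (fun z hz ↦ hG.lower_christoffel hz k j l) i
  rw [pderiv_sum (F := fun m z ↦ G z k m * christoffel G z m j l) fun m _ ↦
    (hG.differentiableAt hy k m).mul (hG.differentiableAt_christoffel hy m j l),
    pderiv_const_mul _ (((hd _ _ _).fun_add (hd _ _ _)).fun_sub (hd _ _ _)),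
    pderiv_sub ((hd _ _ _).fun_add (hd _ _ _)) (hd _ _ _),
    pderiv_add (hd _ _ _) (hd _ _ _)] at h1
  simp only [pderiv_mul (hG.differentiableAt hy k _) (hG.differentiableAt_christoffel hy _ j l),
    Finset.sum_add_distrib, hG.pderiv_metric hy, add_mul] at h1
  linarith

/-- The Riemann tensor in terms of second derivatives of the metric. -/
theorem riemann_eq (i j k l : Fin n) : riemann G y i j k l =
    1 / 2 * (pderiv i (pderiv l (fun z ↦ G z j k)) y - pderiv i (pderiv k (fun z ↦ G z j l)) y
      - pderiv j (pderiv l (fun z ↦ G z i k)) y + pderiv j (pderiv k (fun z ↦ G z i l)) y)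
    - ∑ m, (∑ p, G y m p * christoffel G y p i k) * christoffel G y m j l
    + ∑ m, (∑ p, G y m p * christoffel G y p j k) * christoffel G y m i l := by
  have hq : ∀ a b, ∑ m, G y k m * ∑ p, christoffel G y m a p * christoffel G y p b l =
      ∑ p, (∑ m, G y k m * christoffel G y m a p) * christoffel G y p b l := by
    intro a b
    simp only [Finset.mul_sum, Finset.sum_mul, ← mul_assoc]
    exact Finset.sum_comm
  have h1 := hG.lower_pderiv_christoffel hy i j k l
  have h2 := hG.lower_pderiv_christoffel hy j i k l
  -- The only second derivatives of `G` that drop out are those of `g_{lk}` in the directions `i`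
  -- and `j`.
  have h3 := pderiv_comm hG.isOpen (hG.contDiffOn l k) hy i j
  simp only [riemann, riemannUp, Finset.sum_sub_distrib, mul_add, mul_sub,
    Finset.sum_add_distrib, hq]
  linarith

/-- Visible from `riemann_eq`, given that `G`, the Christoffel symbols and second partial
derivatives are symmetric. It makes the Ricci and Schouten tensors symmetric, and it identifies the
`W_t{}^s{}_{ij}` of the Cotton term with the `W_{ijt}{}^s` of `⋆p_Φ(W)`. -/
theorem riemann_pair_symm (i j k l : Fin n) :
    riemann G y i j k l = riemann G y k l i j := by
  have hp : ∀ a b c d, pderiv a (pderiv b (fun z ↦ G z c d)) y =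
      pderiv a (pderiv b (fun z ↦ G z d c)) y := fun a b c d ↦
    pderiv_congr hG.isOpen hy
      (fun z hz ↦ pderiv_congr hG.isOpen hz (fun w hw ↦ hG.symm w hw c d) b) a
  have hc := fun c d a b ↦ pderiv_comm hG.isOpen (hG.contDiffOn c d) hy a b
  have hq : ∀ a b c d, ∑ m, (∑ p, G y m p * christoffel G y p a b) * christoffel G y m c d =
      ∑ m, (∑ p, G y m p * christoffel G y p c d) * christoffel G y m a b := by
    intro a b c d
    simp only [Finset.sum_mul]
    rw [Finset.sum_comm]
    refine Finset.sum_congr rfl fun m _ ↦ Finset.sum_congr rfl fun p _ ↦ ?_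
    rw [hG.symm y hy p m]
    ring
  have hs := fun p a b ↦ hG.christoffel_symm hy p a b
  rw [hG.riemann_eq hy, hG.riemann_eq hy, hq j k i l]
  simp only [hs _ k i, hs _ l j, hs _ l i, hs _ k j]
  rw [hp k j l i, hp k i l j, hp l j k i, hp l i k j, hc i l k j, hc j l k i, hc i k l j,
    hc j k l i]
  ring

theorem ricci_eq (i j : Fin n) :
    ricci G y i j = ∑ k, ∑ l, (G y)⁻¹ k l * riemann G y k i l j := by
  have := fun k ↦ hG.raise_lower hy (fun m ↦ riemannUp G y k i m j) k
  simp only [raise] at this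
  simp only [ricci, riemann, this]

theorem ricci_symm (i j : Fin n) : ricci G y i j = ricci G y j i := by
  rw [hG.ricci_eq hy, hG.ricci_eq hy, Finset.sum_comm]
  refine Finset.sum_congr rfl fun k _ ↦ Finset.sum_congr rfl fun l _ ↦ ?_
  rw [hG.inv_symm hy, hG.riemann_pair_symm hy]

theorem schouten_symm (i j : Fin n) : schouten G y i j = schouten G y j i := by
  rw [schouten, schouten, hG.ricci_symm hy, hG.symm y hy]

theorem weyl_pair_symm (i j k l : Fin n) : weyl G y i j k l = weyl G y k l i j := by
  rw [weyl, weyl, hG.riemann_pair_symm hy, hG.symm y hy j l, hG.symm y hy j k, hG.symm y hy i k,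
    hG.symm y hy i l, hG.schouten_symm hy i k, hG.schouten_symm hy i l, hG.schouten_symm hy j l,
    hG.schouten_symm hy j k]
  ring

theorem schoutenShift_symm (hu : ContDiffOn ℝ ∞ u U) (i j : Fin n) :
    schoutenShift G u y i j = schoutenShift G u y j i := by
  rw [schoutenShift, schoutenShift, hG.hess_symm hy hu, hG.symm y hy]
  ring

theorem raise_schoutenShift (i k : Fin n) : raise G y (schoutenShift G u y i) k =
    raise G y (hess G u y i) k - pderiv i u y * gradUp G u y k
      + 1 / 2 * gradSq G u y * (if k = i then 1 else 0) := by
  rw [← hG.raise_metric hy]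
  simp only [raise, gradUp, schoutenShift, Finset.mul_sum, ← Finset.sum_sub_distrib,
    ← Finset.sum_add_distrib]
  exact Finset.sum_congr rfl fun l _ ↦ by ring

omit hG hy in
theorem pderiv_pderiv_eq (i j : Fin n) : pderiv i (pderiv j u) y =
    hess G u y i j + ∑ m, christoffel G y m i j * pderiv m u y := by
  simp [hess]

theorem pderiv_christoffelShift (hu : ContDiffOn ℝ ∞ u U) (i k j l : Fin n) :
    pderiv i (fun z ↦ christoffelShift G u z k j l) y =
      (if k = j then 1 else 0) * pderiv i (pderiv l u) y
      + (if k = l then 1 else 0) * pderiv i (pderiv j u) y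
      - (pderiv i (fun z ↦ G z j l) y * gradUp G u y k
        + G y j l * pderiv i (fun z ↦ gradUp G u z k) y) := by
  have hd := fun a ↦ hG.differentiableAt_pderiv hy hu a
  have hg := hG.differentiableAt_gradUp hy hu k
  simp only [christoffelShift]
  rw [pderiv_sub (((hd l).const_mul _).fun_add ((hd j).const_mul _))
    ((hG.differentiableAt hy j l).fun_mul hg),
    pderiv_add ((hd l).const_mul _) ((hd j).const_mul _), pderiv_const_mul _ (hd l),
    pderiv_const_mul _ (hd j), pderiv_mul (hG.differentiableAt hy j l) hg]

/-- The curvature of `∇ + S` is `R + ∇_i S_j - ∇_j S_i + [S_i, S_j]`. The linear part supplies the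
Hessian terms of `A`, the commutator its quadratic terms. -/
theorem riemannUp_rescale (hu : ContDiffOn ℝ ∞ u U) (i j k l : Fin n) :
    riemannUp (rescale u G) y i j k l = riemannUp G y i j k l
      + (if k = j then 1 else 0) * schoutenShift G u y i l
      - (if k = i then 1 else 0) * schoutenShift G u y j l
      - G y j l * raise G y (schoutenShift G u y i) k
      + G y i l * raise G y (schoutenShift G u y j) k := by
  have hud : ∀ z ∈ U, DifferentiableAt ℝ u z := fun z hz ↦
    ContDiffOn.differentiableAt_of_isOpen hG.isOpen hu hz
  have hS : ∀ a b c, DifferentiableAt ℝ (fun z ↦ christoffelShift G u z a b c) y :=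
    fun a b c ↦ by
      have hd := fun a ↦ hG.differentiableAt_pderiv hy hu a
      exact (((hd c).const_mul _).fun_add ((hd b).const_mul _)).fun_sub
        ((hG.differentiableAt hy b c).fun_mul (hG.differentiableAt_gradUp hy hu a))
  have hder : ∀ a b c d, pderiv a (fun z ↦ christoffel (rescale u G) z b c d) y =
      pderiv a (fun z ↦ christoffel G z b c d) y
        + pderiv a (fun z ↦ christoffelShift G u z b c d) y := fun a b c d ↦ by
    rw [pderiv_congr hG.isOpen hy (fun z hz ↦ hG.christoffel_rescale hz (hud z hz) b c d),
      pderiv_add (hG.differentiableAt_christoffel hy b c d) (hS b c d)]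
  have hquad : ∀ a b, ∑ m, christoffel (rescale u G) y k a m * christoffel (rescale u G) y m b l =
      ∑ m, christoffel G y k a m * christoffel G y m b l
      + ∑ m, christoffel G y k a m * christoffelShift G u y m b l
      + ∑ m, christoffelShift G u y k a m * christoffel G y m b l
      + ∑ m, christoffelShift G u y k a m * christoffelShift G u y m b l := fun a b ↦ by
    simp only [hG.christoffel_rescale hy (hud y hy), ← Finset.sum_add_distrib]
    exact Finset.sum_congr rfl fun m _ ↦ by ring
  have hup : ∀ a, ∑ m, christoffelShift G u y k a m * gradUp G u y m =
      (if k = a then 1 else 0) * gradSq G u y := fun a ↦ by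
    rw [sum_christoffelShift_mul (fun m ↦ gradUp G u y m), hG.lower_gradUp hy, gradSq]
    ring
  have hcomm : ∀ a b, ∑ m, pderiv m u y * christoffel G y m a b =
      ∑ m, christoffel G y m a b * pderiv m u y := fun a b ↦
    Finset.sum_congr rfl fun m _ ↦ mul_comm _ _
  have hdg := fun a b ↦ sum_christoffelShift_mul (G := G) (u := u) (y := y)
    (fun m ↦ christoffel G y m b l) k a
  have hs := fun p a b ↦ hG.christoffel_symm hy p a b
  -- Derivatives of `G`, `du` and `∇u` are all rewritten through Hessians and Christoffel symbols,
  -- so that the non-tensorial terms cancel algebraically.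
  simp only [riemannUp, Finset.sum_sub_distrib, hder, hquad, sum_mul_christoffelShift,
    hdg, hup, hcomm,
    hG.pderiv_christoffelShift hy hu, pderiv_pderiv_eq (G := G), hG.pderiv_gradUp hy hu,
    hG.pderiv_metric hy, hG.raise_schoutenShift hy]
  simp only [hs _ j i, hG.hess_symm hy hu j i, schoutenShift, christoffelShift, hG.symm y hy j i]
  ring

end IsMetricOn

end Curvature

/-! ### Conformal change of the Schouten, Weyl and Cotton tensors -/

section ConformalChange

variable {n : ℕ}
  {G : EuclideanSpace ℝ (Fin n) → Matrix (Fin n) (Fin n) ℝ}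
  {U : Set (EuclideanSpace ℝ (Fin n))} {y : EuclideanSpace ℝ (Fin n)}
  {u : EuclideanSpace ℝ (Fin n) → ℝ}

namespace IsMetricOn

variable (hG : IsMetricOn G U) (hy : y ∈ U) (hu : ContDiffOn ℝ ∞ u U)
include hG hy hu

theorem ricci_rescale (i j : Fin n) : ricci (rescale u G) y i j =
    ricci G y i j - ((n : ℝ) - 2) * schoutenShift G u y i j
      - G y i j * ∑ k, raise G y (schoutenShift G u y k) k := by
  have h := hG.lower_raise hy (schoutenShift G u y i) j
  simp only [hG.symm y hy j] at h
  simp only [ricci, hG.riemannUp_rescale hy hu, Finset.sum_add_distrib, Finset.sum_sub_distrib,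
    ite_mul, one_mul, zero_mul, Finset.sum_ite_eq', Finset.mem_univ, if_true, h,
    ← Finset.mul_sum, Finset.sum_const, Finset.card_univ, Fintype.card_fin, nsmul_eq_mul]
  ring

theorem scalarCurv_rescale : scalarCurv (rescale u G) y =
    Real.exp (-(2 * u y)) * (scalarCurv G y
      - 2 * ((n : ℝ) - 1) * ∑ k, raise G y (schoutenShift G u y k) k) := by
  have h1 : ∑ i, ∑ j, (G y)⁻¹ i j * schoutenShift G u y i j =
      ∑ k, raise G y (schoutenShift G u y k) k := rfl
  have h2 : ∑ i, ∑ j, (G y)⁻¹ i j * G y i j = n := by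
    have := fun i ↦ hG.raise_metric hy i i
    simp only [raise, if_true] at this
    simp [this]
  have h3 : ∀ i j, Real.exp (-(2 * u y)) * (G y)⁻¹ i j * (ricci G y i j
      - ((n : ℝ) - 2) * schoutenShift G u y i j
      - G y i j * ∑ k, raise G y (schoutenShift G u y k) k) =
      Real.exp (-(2 * u y)) * ((G y)⁻¹ i j * ricci G y i j
        - ((n : ℝ) - 2) * ((G y)⁻¹ i j * schoutenShift G u y i j)
        - (∑ k, raise G y (schoutenShift G u y k) k) * ((G y)⁻¹ i j * G y i j)) :=
    fun i j ↦ by ring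
  simp only [scalarCurv, hG.ricci_rescale hy hu, hG.rescale_inv hy, Matrix.smul_apply,
    smul_eq_mul, h3, ← Finset.mul_sum, Finset.sum_sub_distrib, h1, h2]
  ring

/-- The Ricci tensor changes by `-(n - 2) A - (tr A) g` and `J g` by `-(tr A) g`, so the trace terms
cancel and division by `n - 2` leaves `-A`. -/
theorem schouten_rescale (hn : 3 ≤ n) (i j : Fin n) :
    schouten (rescale u G) y i j = schouten G y i j - schoutenShift G u y i j := by
  have hexp : Real.exp (-(2 * u y)) * Real.exp (2 * u y) = 1 := by rw [← Real.exp_add]; simp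
  have hn' : (3 : ℝ) ≤ n := by exact_mod_cast hn
  have h1 : (n : ℝ) - 1 ≠ 0 := by linarith
  have h2 : (n : ℝ) - 2 ≠ 0 := by linarith
  simp only [schouten, hG.ricci_rescale hy hu, hG.scalarCurv_rescale hy hu, rescale,
    Matrix.smul_apply, smul_eq_mul]
  field_simp
  linear_combination (-(G y i j) * (scalarCurv G y
      - 2 * ((n : ℝ) - 1) * ∑ k, raise G y (schoutenShift G u y k) k)) * hexp

theorem riemann_rescale (i j k l : Fin n) : riemann (rescale u G) y i j k l =
    Real.exp (2 * u y) * (riemann G y i j k l + G y k j * schoutenShift G u y i l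
      - G y k i * schoutenShift G u y j l - G y j l * schoutenShift G u y i k
      + G y i l * schoutenShift G u y j k) := by
  have h := fun a ↦ hG.lower_raise hy (schoutenShift G u y a) k
  have h3 : ∀ m, Real.exp (2 * u y) * G y k m * (riemannUp G y i j m l
      + (if m = j then 1 else 0) * schoutenShift G u y i l
      - (if m = i then 1 else 0) * schoutenShift G u y j l
      - G y j l * raise G y (schoutenShift G u y i) m
      + G y i l * raise G y (schoutenShift G u y j) m) =
      Real.exp (2 * u y) * (G y k m * riemannUp G y i j m l
      + (if m = j then G y k m else 0) * schoutenShift G u y i l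
      - (if m = i then G y k m else 0) * schoutenShift G u y j l
      - G y j l * (G y k m * raise G y (schoutenShift G u y i) m)
      + G y i l * (G y k m * raise G y (schoutenShift G u y j) m)) := fun m ↦ by
    split_ifs <;> ring
  simp only [riemann, hG.riemannUp_rescale hy hu, rescale, Matrix.smul_apply, smul_eq_mul, h3,
    ← Finset.mul_sum, Finset.sum_add_distrib, Finset.sum_sub_distrib, h, ← Finset.sum_mul,
    Finset.sum_ite_eq', Finset.mem_univ, if_true]

/-- The Weyl tensor is conformally covariant. -/
theorem weyl_rescale (hn : 3 ≤ n) (i j k l : Fin n) :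
    weyl (rescale u G) y i j k l = Real.exp (2 * u y) * weyl G y i j k l := by
  simp only [weyl, hG.riemann_rescale hy hu, hG.schouten_rescale hy hu hn]
  rw [hG.symm y hy k j, hG.symm y hy k i]
  simp only [rescale, Matrix.smul_apply, smul_eq_mul]
  ring

theorem weylRaise4_rescale (hn : 3 ≤ n) (i j t s : Fin n) :
    weylRaise4 (rescale u G) y i j t s = weylRaise4 G y i j t s := by
  have hexp : Real.exp (-(2 * u y)) * Real.exp (2 * u y) = 1 := by rw [← Real.exp_add]; simp
  simp only [weylRaise4, hG.rescale_inv hy, hG.weyl_rescale hy hu hn, Matrix.smul_apply,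
    smul_eq_mul]
  exact Finset.sum_congr rfl fun m _ ↦ by
    linear_combination ((G y)⁻¹ s m * weyl G y i j t m) * hexp

omit hu in
theorem weylRaise2_eq_weylRaise4 (t s i j : Fin n) :
    weylRaise2 G y t s i j = weylRaise4 G y i j t s := by
  simp only [weylRaise2, weylRaise4, hG.weyl_pair_symm hy t]

theorem weylRaise2_rescale (hn : 3 ≤ n) (t s i j : Fin n) :
    weylRaise2 (rescale u G) y t s i j = weylRaise2 G y t s i j := by
  have hexp : Real.exp (-(2 * u y)) * Real.exp (2 * u y) = 1 := by rw [← Real.exp_add]; simp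
  simp only [weylRaise2, hG.rescale_inv hy, hG.weyl_rescale hy hu hn, Matrix.smul_apply,
    smul_eq_mul]
  exact Finset.sum_congr rfl fun m _ ↦ by
    linear_combination ((G y)⁻¹ s m * weyl G y t m i j) * hexp

-- The corrections `Γ^l_{ij} P_{lk}` cancel because the connection is torsion-free. Stated for a
-- general `H` so as to serve both `G` and its rescaling.
omit hG hy hu in
theorem cotton_eq (H : EuclideanSpace ℝ (Fin n) → Matrix (Fin n) (Fin n) ℝ)
    (hs : ∀ k i j, christoffel H y k i j = christoffel H y k j i) (i j k : Fin n) :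
    cotton H y i j k =
      pderiv i (fun z ↦ schouten H z j k) y - pderiv j (fun z ↦ schouten H z i k) y
      - ∑ l, christoffel H y l i k * schouten H y j l
      + ∑ l, christoffel H y l j k * schouten H y i l := by
  have h0 : ∀ a b l : Fin n, Function.update ![a, b] 0 l = ![l, b] := fun a b l ↦ by
    ext c; fin_cases c <;> rfl
  have h1 : ∀ a b l : Fin n, Function.update ![a, b] 1 l = ![a, l] := fun a b l ↦ by
    ext c; fin_cases c <;> rfl
  simp only [cotton, covDeriv, Fin.sum_univ_two, h0, h1, Matrix.cons_val_zero,
    Matrix.cons_val_one, hs _ j i]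
  ring

theorem pderiv_gradSq (i : Fin n) :
    pderiv i (gradSq G u) y = 2 * ∑ m, hess G u y i m * gradUp G u y m := by
  have hd := fun a ↦ hG.differentiableAt_pderiv hy hu a
  have hg := fun a ↦ hG.differentiableAt_gradUp hy hu a
  change pderiv i (fun z ↦ ∑ m, pderiv m u z * gradUp G u z m) y = _
  rw [pderiv_sum (F := fun m z ↦ pderiv m u z * gradUp G u z m) fun m _ ↦ (hd m).fun_mul (hg m)]
  have h : ∑ m, pderiv m u y * raise G y (hess G u y i) m =
      ∑ m, hess G u y i m * gradUp G u y m := by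
    rw [← hG.sum_raise_mul hy]
    exact Finset.sum_congr rfl fun m _ ↦ mul_comm _ _
  have h2 : ∑ m, (∑ p, christoffel G y p i m * pderiv p u y) * gradUp G u y m =
      ∑ p, pderiv p u y * ∑ m, christoffel G y p i m * gradUp G u y m := by
    simp only [Finset.sum_mul, Finset.mul_sum]
    rw [Finset.sum_comm]
    exact Finset.sum_congr rfl fun m _ ↦ Finset.sum_congr rfl fun p _ ↦ by ring
  simp only [pderiv_mul (hd _) (hg _), hG.pderiv_gradUp hy hu, pderiv_pderiv_eq (G := G),
    Finset.sum_add_distrib, mul_sub, Finset.sum_sub_distrib, add_mul, h, h2]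
  ring

/-- The Ricci identity for the differential of `u`. -/
theorem hess_commutator (i j k : Fin n) :
    pderiv i (fun z ↦ hess G u z j k) y - pderiv j (fun z ↦ hess G u z i k) y
      - ∑ l, christoffel G y l i k * hess G u y j l
      + ∑ l, christoffel G y l j k * hess G u y i l =
    -∑ l, riemannUp G y i j l k * pderiv l u y := by
  have hd := fun a ↦ hG.differentiableAt_pderiv hy hu a
  have hdd := fun a b ↦ hG.differentiableAt_pderiv hy (contDiffOn_pderiv hG.isOpen hu a) b
  have hc := fun a b c ↦ hG.differentiableAt_christoffel hy a b c
  have key : ∀ a b, pderiv a (fun z ↦ hess G u z b k) y = pderiv a (pderiv b (pderiv k u)) y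
      - (∑ m, pderiv a (fun z ↦ christoffel G z m b k) y * pderiv m u y
        + ∑ m, christoffel G y m b k * hess G u y a m
        + ∑ m, christoffel G y m b k * ∑ p, christoffel G y p a m * pderiv p u y) := by
    intro a b
    simp only [hess]
    rw [pderiv_sub (hdd _ _) (DifferentiableAt.fun_sum fun m _ ↦ (hc m b k).fun_mul (hd m)),
      pderiv_sum (F := fun m z ↦ christoffel G z m b k * pderiv m u z)
        fun m _ ↦ (hc m b k).fun_mul (hd m)]
    simp only [pderiv_mul (hc _ _ _) (hd _), ← Finset.sum_add_distrib]
    congr 1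
    exact Finset.sum_congr rfl fun m _ ↦ by ring
  have h3 := pderiv_comm hG.isOpen (contDiffOn_pderiv hG.isOpen hu k) hy i j
  have hq : ∀ a b, ∑ m, christoffel G y m b k * ∑ p, christoffel G y p a m * pderiv p u y =
      ∑ p, (∑ m, christoffel G y p a m * christoffel G y m b k) * pderiv p u y := by
    intro a b
    simp only [Finset.mul_sum, Finset.sum_mul]
    rw [Finset.sum_comm]
    exact Finset.sum_congr rfl fun m _ ↦ Finset.sum_congr rfl fun p _ ↦ by ring
  simp only [key, hq, riemannUp, add_mul, sub_mul, Finset.sum_add_distrib,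
    Finset.sum_sub_distrib]
  linarith

theorem pderiv_schoutenShift (i j k : Fin n) :
    pderiv i (fun z ↦ schoutenShift G u z j k) y = pderiv i (fun z ↦ hess G u z j k) y
      - (pderiv i (pderiv j u) y * pderiv k u y + pderiv j u y * pderiv i (pderiv k u) y)
      + ((∑ m, hess G u y i m * gradUp G u y m) * G y j k
        + 1 / 2 * gradSq G u y * pderiv i (fun z ↦ G z j k) y) := by
  have hd := fun a ↦ hG.differentiableAt_pderiv hy hu a
  have hh := ContDiffOn.differentiableAt_of_isOpen hG.isOpen (hG.contDiffOn_hess hu j k) hy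
  have hq := ContDiffOn.differentiableAt_of_isOpen hG.isOpen (hG.contDiffOn_gradSq hu) hy
  have hg := hG.differentiableAt hy j k
  simp only [schoutenShift]
  rw [pderiv_add (hh.fun_sub ((hd j).fun_mul (hd k))) ((hq.const_mul _).fun_mul hg),
    pderiv_sub hh ((hd j).fun_mul (hd k)), pderiv_mul (hd j) (hd k),
    pderiv_mul (hq.const_mul _) hg, pderiv_const_mul _ hq, hG.pderiv_gradSq hy hu]
  ring

/-- Third derivatives of `u` enter only through the Ricci identity. Of the product `u_j u_k` only
terms without `∇_i u_j` survive skewing, and since `g` is parallel the last term of `A` contributes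
only `d|∇u|² / 2`. -/
theorem schoutenShift_commutator (i j k : Fin n) :
    pderiv i (fun z ↦ schoutenShift G u z j k) y - pderiv j (fun z ↦ schoutenShift G u z i k) y
      - ∑ l, christoffel G y l i k * schoutenShift G u y j l
      + ∑ l, christoffel G y l j k * schoutenShift G u y i l =
    -∑ l, riemannUp G y i j l k * pderiv l u y
      - pderiv j u y * hess G u y i k + pderiv i u y * hess G u y j k
      + (∑ m, hess G u y i m * gradUp G u y m) * G y j k
      - (∑ m, hess G u y j m * gradUp G u y m) * G y i k := by
  rw [← hG.hess_commutator hy hu]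
  have h : ∀ a b, ∑ l, christoffel G y l a k * schoutenShift G u y b l =
      ∑ l, christoffel G y l a k * hess G u y b l
      - pderiv b u y * ∑ l, christoffel G y l a k * pderiv l u y
      + 1 / 2 * gradSq G u y * ∑ l, G y b l * christoffel G y l a k := by
    intro a b
    simp only [schoutenShift, Finset.mul_sum, ← Finset.sum_add_distrib, ← Finset.sum_sub_distrib]
    exact Finset.sum_congr rfl fun m _ ↦ by ring
  simp only [h, hG.pderiv_schoutenShift hy hu, hG.pderiv_metric hy, pderiv_pderiv_eq (G := G),
    hG.hess_symm hy hu j i, fun l ↦ hG.christoffel_symm hy l j i]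
  ring

/-- The conformal change of the Cotton tensor. -/
theorem cotton_rescale (hn : 3 ≤ n) (i j k : Fin n) :
    cotton (rescale u G) y i j k = cotton G y i j k + ∑ l, gradUp G u y l * weyl G y i j l k := by
  have hud := ContDiffOn.differentiableAt_of_isOpen hG.isOpen hu hy
  have hP := fun a b ↦
    ContDiffOn.differentiableAt_of_isOpen hG.isOpen (hG.contDiffOn_schouten a b) hy
  have hA := fun a b ↦
    ContDiffOn.differentiableAt_of_isOpen hG.isOpen (hG.contDiffOn_schoutenShift hu a b) hy
  have hder : ∀ a b c, pderiv a (fun z ↦ schouten (rescale u G) z b c) y =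
      pderiv a (fun z ↦ schouten G z b c) y - pderiv a (fun z ↦ schoutenShift G u z b c) y :=
    fun a b c ↦ by
      rw [pderiv_congr hG.isOpen hy (fun z hz ↦ hG.schouten_rescale hz hu hn b c),
        pderiv_sub (hP b c) (hA b c)]
  have hs := fun p a b ↦ hG.christoffel_symm hy p a b
  have hs' : ∀ p a b, christoffel (rescale u G) y p a b = christoffel (rescale u G) y p b a :=
    fun p a b ↦ by
      rw [hG.christoffel_rescale hy hud, hG.christoffel_rescale hy hud, hs p a b,
        christoffelShift, christoffelShift, hG.symm y hy a b]
      ring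
  have hquad : ∀ a b, ∑ l, christoffel (rescale u G) y l a k * schouten (rescale u G) y b l =
      ∑ l, christoffel G y l a k * schouten G y b l
      - ∑ l, christoffel G y l a k * schoutenShift G u y b l
      + (∑ l, schouten G y b l * christoffelShift G u y l a k
      - ∑ l, schoutenShift G u y b l * christoffelShift G u y l a k) := fun a b ↦ by
    simp only [hG.christoffel_rescale hy hud, hG.schouten_rescale hy hu hn,
      ← Finset.sum_add_distrib, ← Finset.sum_sub_distrib]
    exact Finset.sum_congr rfl fun m _ ↦ by ring
  have hcom := hG.schoutenShift_commutator hy hu i j k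
  have hAup : ∀ a, ∑ l, schoutenShift G u y a l * gradUp G u y l =
      ∑ l, hess G u y a l * gradUp G u y l - 1 / 2 * pderiv a u y * gradSq G u y := fun a ↦ by
    have h : ∑ l, schoutenShift G u y a l * gradUp G u y l =
        ∑ l, hess G u y a l * gradUp G u y l
        - pderiv a u y * ∑ l, pderiv l u y * gradUp G u y l
        + 1 / 2 * gradSq G u y * ∑ l, G y a l * gradUp G u y l := by
      simp only [schoutenShift, Finset.mul_sum, ← Finset.sum_add_distrib,
        ← Finset.sum_sub_distrib]
      exact Finset.sum_congr rfl fun m _ ↦ by ring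
    rw [h, hG.lower_gradUp hy, ← gradSq]
    ring
  have hR : ∑ l, gradUp G u y l * riemann G y i j l k =
      ∑ l, riemannUp G y i j l k * pderiv l u y := by
    simp only [← hG.lower_gradUp hy, riemann, Finset.mul_sum]
    rw [Finset.sum_comm]
    refine Finset.sum_congr rfl fun m _ ↦ Finset.sum_congr rfl fun p _ ↦ ?_
    rw [hG.symm y hy p m]
    ring
  -- Contracting the Weyl decomposition with `u^l` turns its metric factors into derivatives of `u`:
  -- these are the terms that `S` produces when it acts on `P`.
  have hW : ∑ l, gradUp G u y l * weyl G y i j l k =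
      ∑ l, riemannUp G y i j l k * pderiv l u y
      - (∑ l, schouten G y i l * gradUp G u y l) * G y j k
      + schouten G y i k * pderiv j u y
      - schouten G y j k * pderiv i u y
      + (∑ l, schouten G y j l * gradUp G u y l) * G y i k := by
    rw [← hR, ← hG.lower_gradUp hy i, ← hG.lower_gradUp hy j]
    simp only [weyl, Finset.mul_sum, Finset.sum_mul, ← Finset.sum_add_distrib,
      ← Finset.sum_sub_distrib]
    exact Finset.sum_congr rfl fun m _ ↦ by ring
  rw [cotton_eq _ hs', cotton_eq _ hs, hW, hder, hder, hquad, hquad]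
  simp only [sum_mul_christoffelShift, hAup]
  have e1 : schoutenShift G u y j k =
    hess G u y j k - pderiv j u y * pderiv k u y + 1 / 2 * gradSq G u y * G y j k := rfl
  have e2 : schoutenShift G u y i k =
    hess G u y i k - pderiv i u y * pderiv k u y + 1 / 2 * gradSq G u y * G y i k := rfl
  -- Symmetry of `P` and `A` removes the terms `P_{ij} u_k` and `A_{ij} u_k`, leaving the skewed
  -- derivative of `A`.
  rw [e1, e2, hG.schouten_symm hy j i, hG.schoutenShift_symm hy hu j i]
  linear_combination -hcom

theorem cottonRaise2_rescale (hn : 3 ≤ n) (t s i : Fin n) :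
    Real.exp (2 * u y) * cottonRaise2 (rescale u G) y t s i =
      cottonRaise2 G y t s i + ∑ l, gradUp G u y l * weylRaise2 G y t s l i := by
  have hexp : Real.exp (2 * u y) * Real.exp (-(2 * u y)) = 1 := by rw [← Real.exp_add]; simp
  simp only [cottonRaise2, hG.rescale_inv hy, hG.cotton_rescale hy hu hn, Matrix.smul_apply,
    smul_eq_mul, weylRaise2, Finset.mul_sum]
  rw [Finset.sum_comm (f := fun l m ↦ gradUp G u y l * ((G y)⁻¹ s m * weyl G y t m l i)),
    ← Finset.sum_add_distrib]
  refine Finset.sum_congr rfl fun m _ ↦ ?_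
  rw [← mul_assoc, ← mul_assoc, hexp, one_mul, mul_add, Finset.mul_sum]
  congr 1
  exact Finset.sum_congr rfl fun l _ ↦ by ring

end IsMetricOn

end ConformalChange

/-! ### Fixing the first slot of a skew symmetrization -/

section SkewSymmetrization

variable {n : ℕ}

/-- Left translation by `π` permutes the summands. -/
theorem skew_comp {m : ℕ} (T : (Fin m → Fin n) → ℝ) (π : Equiv.Perm (Fin m)) (i : Fin m → Fin n) :
    skew T (i ∘ π) = ((Equiv.Perm.sign π : ℤ) : ℝ) * skew T i := by
  simp only [skew]
  rw [mul_left_comm]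
  congr 1
  rw [Finset.mul_sum, ← Equiv.sum_comp (Equiv.mulLeft π)
    (fun σ ↦ ((Equiv.Perm.sign π : ℤ) : ℝ) * (((Equiv.Perm.sign σ : ℤ) : ℝ) * T (i ∘ σ)))]
  refine Finset.sum_congr rfl fun σ _ ↦ ?_
  have h : ((Equiv.Perm.sign π : ℤ) : ℝ) * ((Equiv.Perm.sign π : ℤ) : ℝ) = 1 := by
    exact_mod_cast Int.units_coe_mul_self (Equiv.Perm.sign π)
  rw [Equiv.coe_mulLeft, Equiv.Perm.sign_mul, Equiv.Perm.coe_mul, ← Function.comp_assoc]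
  push_cast
  linear_combination (-((Equiv.Perm.sign σ : ℤ) : ℝ) * T ((i ∘ π) ∘ σ)) * h

/-- `T` changes by the sign of `π` when its arguments are permuted by `π`. -/
def IsSignInvariant {m : ℕ} (T : (Fin m → Fin n) → ℝ) (π : Equiv.Perm (Fin m)) : Prop :=
  ∀ i, T (i ∘ π) = ((Equiv.Perm.sign π : ℤ) : ℝ) * T i

theorem IsSignInvariant.mul {m : ℕ} {T : (Fin m → Fin n) → ℝ} {π π' : Equiv.Perm (Fin m)}
    (h : IsSignInvariant T π) (h' : IsSignInvariant T π') : IsSignInvariant T (π * π') := by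
  intro i
  rw [Equiv.Perm.coe_mul, ← Function.comp_assoc, h', h, Equiv.Perm.sign_mul]
  push_cast
  ring

theorem isSignInvariant_one {m : ℕ} (T : (Fin m → Fin n) → ℝ) : IsSignInvariant T 1 := by
  intro i
  simp

/-- If every slot of `T` can be moved to the first one by a permutation under which `T` is sign
invariant, then skew symmetrizing over all slots amounts to fixing the first slot and skew
symmetrizing over the others. -/
theorem skew_cons {m : ℕ} (T : (Fin (m + 1) → Fin n) → ℝ)
    (hT : ∀ b, ∃ π : Equiv.Perm (Fin (m + 1)), π b = 0 ∧ IsSignInvariant T π)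
    (l : Fin n) (I : Fin m → Fin n) :
    skew T (Fin.cons l I : Fin (m + 1) → Fin n) =
      skew (fun J : Fin m → Fin n ↦ T (Fin.cons l J : Fin (m + 1) → Fin n)) I := by
  set i : Fin (m + 1) → Fin n := Fin.cons l I with hi
  set F : Equiv.Perm (Fin (m + 1)) → ℝ := fun σ ↦ ((Equiv.Perm.sign σ : ℤ) : ℝ) * T (i ∘ σ)
    with hF
  have hmul : ∀ σ π, IsSignInvariant T π → F (σ * π) = F σ := by
    intro σ π hπ
    have h : ((Equiv.Perm.sign π : ℤ) : ℝ) * ((Equiv.Perm.sign π : ℤ) : ℝ) = 1 := by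
      exact_mod_cast Int.units_coe_mul_self (Equiv.Perm.sign π)
    simp only [hF]
    rw [Equiv.Perm.coe_mul, ← Function.comp_assoc, hπ, Equiv.Perm.sign_mul]
    push_cast
    linear_combination (((Equiv.Perm.sign σ : ℤ) : ℝ) * T (i ∘ σ)) * h
  -- The permutations are sorted by the slot `b` that receives `l`. Right translation by the
  -- symmetry moving `b` to `0` shows that all `m + 1` classes contribute equally.
  have hfib : ∀ b, ∑ σ, (if σ b = 0 then F σ else 0) = ∑ σ, if σ 0 = 0 then F σ else 0 := by
    intro b
    obtain ⟨π, hπ, hπT⟩ := hT b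
    rw [← Equiv.sum_comp (Equiv.mulRight π)]
    simp only [Equiv.coe_mulRight, Equiv.Perm.mul_apply, hπ, hmul _ π hπT]
  have hsum : ∑ σ, F σ = ((m : ℝ) + 1) * ∑ σ, if σ 0 = 0 then F σ else 0 := by
    have h : ∀ σ : Equiv.Perm (Fin (m + 1)), F σ = ∑ b, if σ b = 0 then F σ else 0 := by
      intro σ
      rw [← Equiv.sum_comp σ⁻¹]
      simp
    rw [Finset.sum_congr rfl fun σ _ ↦ h σ, Finset.sum_comm]
    simp [hfib]
  -- The stabilizer of `0` is the permutation group of the remaining `m` slots, with the same signs.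
  have hstab : ∑ σ, (if σ 0 = 0 then F σ else 0) = ∑ e : Equiv.Perm (Fin m),
      ((Equiv.Perm.sign e : ℤ) : ℝ) * T (Fin.cons l (I ∘ e) : Fin (m + 1) → Fin n) := by
    rw [← Equiv.sum_comp Equiv.Perm.decomposeFin.symm, Fintype.sum_prod_type]
    simp only [Equiv.Perm.decomposeFin_symm_apply_zero]
    rw [Finset.sum_eq_single 0 (fun b _ hb ↦ by simp [hb]) (by simp)]
    refine Finset.sum_congr rfl fun e _ ↦ ?_
    have hcomp : i ∘ Equiv.Perm.decomposeFin.symm (0, e) = Fin.cons l (I ∘ e) := by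
      funext a
      refine Fin.cases ?_ (fun b ↦ ?_) a
      · simp [hi]
      · simp [hi, Equiv.Perm.decomposeFin_symm_apply_succ]
    simp [hF, hcomp, Equiv.Perm.decomposeFin.symm_sign]
  have hm : ((m : ℝ) + 1) ≠ 0 := by positivity
  have hmf : (m.factorial : ℝ) ≠ 0 := by positivity
  simp only [skew]
  rw [← hstab]
  change 1 / ((m + 1).factorial : ℝ) * ∑ σ, F σ = _
  rw [hsum, Nat.factorial_succ]
  push_cast
  field_simp

/-- With `k + 1` in place of `k`, the truncated subtraction `2 * (k + 1) - 1` reduces definitionally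
to `2 * k + 1`. -/
theorem consIndex_succ {k : ℕ} (l : Fin n) (I : Fin (2 * (k + 1) - 1) → Fin n) :
    consIndex l I = (Fin.cons l I : Fin (2 * k + 1 + 1) → Fin n) := by
  funext a
  refine Fin.cases ?_ (fun b ↦ ?_) a
  · rfl
  · rfl

theorem skew_consIndex {k : ℕ} (hk : 1 ≤ k) (T : (Fin (2 * k) → Fin n) → ℝ)
    (hT : ∀ b, ∃ π : Equiv.Perm (Fin (2 * k)), π b = ⟨0, by omega⟩ ∧ IsSignInvariant T π)
    (l : Fin n) (I : Fin (2 * k - 1) → Fin n) :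
    skew T (consIndex l I) = skew (fun J ↦ T (consIndex l J)) I := by
  obtain ⟨k, rfl⟩ : ∃ k', k = k' + 1 := ⟨k - 1, by omega⟩
  simp only [consIndex_succ]
  exact skew_cons (m := 2 * k + 1) T hT l I

theorem skew_linear {m : ℕ} {ι : Type*} (s : Finset ι) (T : (Fin m → Fin n) → ℝ)
    (v : ι → ℝ) (S : ι → (Fin m → Fin n) → ℝ) (I : Fin m → Fin n) :
    skew (fun J ↦ T J + ∑ l ∈ s, v l * S l J) I = skew T I + ∑ l ∈ s, v l * skew (S l) I := by
  simp only [skew, mul_add, Finset.sum_add_distrib, Finset.mul_sum]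
  congr 1
  rw [Finset.sum_comm]
  exact Finset.sum_congr rfl fun l _ ↦ Finset.sum_congr rfl fun σ _ ↦ by ring

theorem mul_skew {m : ℕ} (c : ℝ) (T : (Fin m → Fin n) → ℝ) (I : Fin m → Fin n) :
    c * skew T I = skew (fun J ↦ c * T J) I := by
  simp only [skew, Finset.mul_sum]
  exact Finset.sum_congr rfl fun σ _ ↦ by ring

end SkewSymmetrization

/-! ### Signed symmetries of the unskewed tensor -/

section BlockSymmetry

variable {n k : ℕ} (Φ : InvariantPolynomial n k) (w : Fin n → Fin n → Fin n → Fin n → ℝ)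

/-- The tensor `Φ_{s_1 ⋯ s_k}^{t_1 ⋯ t_k} w_{i_1 i_2 t_1}{}^{s_1} ⋯ w_{i_{2k-1} i_{2k} t_k}{}^{s_k}`. -/
noncomputable def phiTensor (i : Fin (2 * k) → Fin n) : ℝ :=
  ∑ s : Fin k → Fin n, ∑ t : Fin k → Fin n, Φ.comp s t *
    ∏ a : Fin k, w (i ⟨2 * (a : ℕ), by omega⟩) (i ⟨2 * (a : ℕ) + 1, by omega⟩) (t a) (s a)

theorem isSignInvariant_swap_pair (hw : ∀ i j t s, w i j t s = -w j i t s) (a : Fin k) :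
    IsSignInvariant (phiTensor Φ w)
      (Equiv.swap ⟨2 * (a : ℕ), by omega⟩ ⟨2 * (a : ℕ) + 1, by omega⟩) := by
  intro i
  rw [Equiv.Perm.sign_swap (by simp [Fin.ext_iff])]
  simp only [phiTensor, Finset.mul_sum]
  refine Finset.sum_congr rfl fun s _ ↦ Finset.sum_congr rfl fun t _ ↦ ?_
  rw [mul_left_comm]
  congr 1
  -- The sign is spread over the factors, all of it in factor `a`, so that the products can be
  -- compared termwise.
  have h : (((-1 : ℤˣ) : ℤ) : ℝ) = ∏ c : Fin k, if c = a then (-1 : ℝ) else 1 := by simp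
  rw [h, ← Finset.prod_mul_distrib]
  refine Finset.prod_congr rfl fun c _ ↦ ?_
  by_cases hc : c = a
  · subst hc
    simp only [Function.comp_apply, Equiv.swap_apply_left, Equiv.swap_apply_right, if_true]
    rw [hw]
    ring
  · have hc' : (c : ℕ) ≠ a := fun h ↦ hc (Fin.ext h)
    rw [if_neg hc, one_mul, Function.comp_apply, Function.comp_apply,
      Equiv.swap_apply_of_ne_of_ne (by simp only [ne_eq, Fin.mk.injEq]; omega)
        (by simp only [ne_eq, Fin.mk.injEq]; omega),
      Equiv.swap_apply_of_ne_of_ne (by simp only [ne_eq, Fin.mk.injEq]; omega)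
        (by simp only [ne_eq, Fin.mk.injEq]; omega)]

/-- Exchanging two factors is undone by relabelling `s` and `t`, which `Φ.symm` allows. The
permutation is a product of two transpositions, hence even. -/
theorem isSignInvariant_swap_blocks {a b : Fin k} (hab : a ≠ b) :
    IsSignInvariant (phiTensor Φ w)
      (Equiv.swap ⟨2 * (a : ℕ), by omega⟩ ⟨2 * (b : ℕ), by omega⟩ *
        Equiv.swap ⟨2 * (a : ℕ) + 1, by omega⟩ ⟨2 * (b : ℕ) + 1, by omega⟩) := by
  intro i
  have hab' : (a : ℕ) ≠ b := fun h ↦ hab (Fin.ext h)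
  rw [Equiv.Perm.sign_mul, Equiv.Perm.sign_swap (by simp only [ne_eq, Fin.mk.injEq]; omega),
    Equiv.Perm.sign_swap (by simp only [ne_eq, Fin.mk.injEq]; omega)]
  set π : Equiv.Perm (Fin (2 * k)) :=
    Equiv.swap ⟨2 * (a : ℕ), by omega⟩ ⟨2 * (b : ℕ), by omega⟩ *
      Equiv.swap ⟨2 * (a : ℕ) + 1, by omega⟩ ⟨2 * (b : ℕ) + 1, by omega⟩ with hπ
  have h0 : ∀ c : Fin k, π ⟨2 * (c : ℕ), by omega⟩ =
      ⟨2 * (Equiv.swap a b c : ℕ), by omega⟩ := by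
    intro c
    simp only [hπ, Equiv.Perm.mul_apply, Equiv.swap_apply_def, Fin.ext_iff, apply_ite Fin.val]
    split_ifs <;> omega
  have h1 : ∀ c : Fin k, π ⟨2 * (c : ℕ) + 1, by omega⟩ =
      ⟨2 * (Equiv.swap a b c : ℕ) + 1, by omega⟩ := by
    intro c
    simp only [hπ, Equiv.Perm.mul_apply, Equiv.swap_apply_def, Fin.ext_iff, apply_ite Fin.val]
    split_ifs <;> omega
  simp only [phiTensor, Function.comp_apply, h0, h1]
  rw [← Equiv.sum_comp (Equiv.arrowCongr (Equiv.swap a b) (Equiv.refl (Fin n)))]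
  have hone : (((-1 * -1 : ℤˣ) : ℤ) : ℝ) = 1 := by norm_num
  rw [hone, one_mul]
  refine Finset.sum_congr rfl fun s _ ↦ ?_
  rw [← Equiv.sum_comp (Equiv.arrowCongr (Equiv.swap a b) (Equiv.refl (Fin n)))]
  refine Finset.sum_congr rfl fun t _ ↦ ?_
  have hc : ∀ r : Fin k → Fin n,
      Equiv.arrowCongr (Equiv.swap a b) (Equiv.refl (Fin n)) r = r ∘ Equiv.swap a b := fun r ↦ by
    funext c
    simp [Equiv.arrowCongr]
  rw [hc, hc, Φ.symm]
  congr 1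
  rw [← Equiv.prod_comp (Equiv.swap a b)]
  simp

/-- An even slot reaches the first one by a block exchange; an odd slot is first exchanged with its
partner. This is the hypothesis of `skew_consIndex`. -/
theorem exists_isSignInvariant_phiTensor (hk : 1 ≤ k) (hw : ∀ i j t s, w i j t s = -w j i t s)
    (b : Fin (2 * k)) : ∃ π : Equiv.Perm (Fin (2 * k)),
      π b = ⟨0, by omega⟩ ∧ IsSignInvariant (phiTensor Φ w) π := by
  have heven : ∀ a : Fin k, ∃ π : Equiv.Perm (Fin (2 * k)),
      π ⟨2 * (a : ℕ), by omega⟩ = ⟨0, by omega⟩ ∧ IsSignInvariant (phiTensor Φ w) π := by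
    intro a
    by_cases ha : a = ⟨0, hk⟩
    · subst ha
      exact ⟨1, rfl, isSignInvariant_one _⟩
    · refine ⟨_, ?_, isSignInvariant_swap_blocks Φ w ha⟩
      simp only [Equiv.Perm.mul_apply, Equiv.swap_apply_def, Fin.ext_iff, apply_ite Fin.val]
      split_ifs <;> omega
  obtain ⟨π, hπ, hπT⟩ := heven ⟨(b : ℕ) / 2, by omega⟩
  rcases Nat.even_or_odd' (b : ℕ) with ⟨c, hc | hc⟩
  · refine ⟨π, ?_, hπT⟩
    rw [← hπ]
    congr 1
    ext
    simp only
    omega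
  · refine ⟨_, ?_, hπT.mul (isSignInvariant_swap_pair Φ w hw ⟨(b : ℕ) / 2, by omega⟩)⟩
    rw [Equiv.Perm.mul_apply, ← hπ]
    congr 1
    simp only [Equiv.swap_apply_def, Fin.ext_iff, apply_ite Fin.val]
    split_ifs <;> omega

end BlockSymmetry

/-! ### Conformal change of the divergence of a form -/

section Divergence

variable {n : ℕ}
  {G : EuclideanSpace ℝ (Fin n) → Matrix (Fin n) (Fin n) ℝ}
  {U : Set (EuclideanSpace ℝ (Fin n))} {y : EuclideanSpace ℝ (Fin n)}
  {u : EuclideanSpace ℝ (Fin n) → ℝ}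

theorem cons_update_comp_swap {m : ℕ} (i j : Fin n) (I : Fin m → Fin n) (b : Fin m) :
    (Fin.cons i (Function.update I b j) : Fin (m + 1) → Fin n) ∘ Equiv.swap 0 b.succ =
      Fin.cons j (Function.update I b i) := by
  funext a
  rw [Function.comp_apply]
  refine Fin.cases ?_ (fun c ↦ ?_) a
  · simp
  · by_cases hc : c = b
    · subst hc
      simp
    · rw [Equiv.swap_apply_of_ne_of_ne (Fin.succ_ne_zero c) (fun h ↦ hc (Fin.succ_injective _ h))]
      simp [hc]

/-- The conformal change of the divergence of an `(m + 1)`-form. -/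
theorem IsMetricOn.divergence_rescale (hG : IsMetricOn G U) (hy : y ∈ U)
    (hu : DifferentiableAt ℝ u y) {m : ℕ}
    (η : EuclideanSpace ℝ (Fin n) → (Fin (m + 1) → Fin n) → ℝ)
    (hη : ∀ (π : Equiv.Perm (Fin (m + 1))) (i : Fin (m + 1) → Fin n),
      η y (i ∘ π) = ((Equiv.Perm.sign π : ℤ) : ℝ) * η y i) (I : Fin m → Fin n) :
    Real.exp (2 * u y) * ∑ i, ∑ j, (rescale u G y)⁻¹ i j *
        covDeriv (rescale u G) y η j (Fin.cons i I : Fin (m + 1) → Fin n) =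
      ∑ i, ∑ j, (G y)⁻¹ i j * covDeriv G y η j (Fin.cons i I : Fin (m + 1) → Fin n)
        + ((n : ℝ) - 2 * ((m : ℝ) + 1)) *
          ∑ l, gradUp G u y l * η y (Fin.cons l I : Fin (m + 1) → Fin n) := by
  have hexp : Real.exp (2 * u y) * Real.exp (-(2 * u y)) = 1 := by rw [← Real.exp_add]; simp
  set S : ℝ := ∑ l, gradUp G u y l * η y (Fin.cons l I : Fin (m + 1) → Fin n) with hS
  have hswap : ∀ i j b, η y (Fin.cons i (Function.update I b j) : Fin (m + 1) → Fin n) =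
      -η y (Fin.cons j (Function.update I b i) : Fin (m + 1) → Fin n) := by
    intro i j b
    rw [← cons_update_comp_swap i j, hη, Equiv.Perm.sign_swap (Fin.succ_ne_zero b).symm]
    simp
  -- The partial derivative of `η` is common to both sides, so no differentiability of `η` is
  -- needed.
  have hcov : ∀ i j, covDeriv (rescale u G) y η j (Fin.cons i I : Fin (m + 1) → Fin n) =
      covDeriv G y η j (Fin.cons i I : Fin (m + 1) → Fin n)
      - ((∑ l, η y (Fin.cons l I : Fin (m + 1) → Fin n) * christoffelShift G u y l j i)
        + ∑ b, ∑ l, η y (Fin.cons i (Function.update I b l) : Fin (m + 1) → Fin n)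
            * christoffelShift G u y l j (I b)) := by
    intro i j
    simp only [covDeriv, hG.christoffel_rescale hy hu, add_mul, Finset.sum_add_distrib]
    rw [← sub_sub]
    congr 1
    rw [Fin.sum_univ_succ]
    simp only [Fin.cons_zero, Fin.cons_succ, Fin.update_cons_zero, ← Fin.cons_update,
      mul_comm (christoffelShift _ _ _ _ _ _)]
  have hvS : ∀ j, (∑ i, (G y)⁻¹ i j * pderiv i u y) = gradUp G u y j := by
    intro j
    simp only [gradUp, raise, hG.inv_symm hy j]
  have hinv : ∀ i k, ∑ j, (G y)⁻¹ i j * G y j k = if i = k then 1 else 0 :=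
    fun i k ↦ hG.sum_inv_mul hy i k
  -- The contracted slot contributes the trace `g^{ij} S^l_{ji} = (2 - n) u^l`.
  have hfirst : ∑ i, ∑ j, (G y)⁻¹ i j *
      ∑ l, η y (Fin.cons l I : Fin (m + 1) → Fin n) * christoffelShift G u y l j i =
      (2 - (n : ℝ)) * S := by
    have h1 : ∑ i, ∑ j, (G y)⁻¹ i j *
        (η y (Fin.cons j I : Fin (m + 1) → Fin n) * pderiv i u y) = S := by
      rw [Finset.sum_comm, hS]
      refine Finset.sum_congr rfl fun j _ ↦ ?_
      rw [← hvS, Finset.sum_mul]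
      exact Finset.sum_congr rfl fun i _ ↦ by ring
    have h2 : ∑ i, ∑ j, (G y)⁻¹ i j *
        (η y (Fin.cons i I : Fin (m + 1) → Fin n) * pderiv j u y) = S := by
      rw [hS]
      refine Finset.sum_congr rfl fun i _ ↦ ?_
      rw [gradUp, raise, Finset.sum_mul]
      exact Finset.sum_congr rfl fun j _ ↦ by ring
    have h3 : ∑ i, ∑ j, (G y)⁻¹ i j * (G y j i * ∑ l,
        η y (Fin.cons l I : Fin (m + 1) → Fin n) * gradUp G u y l) = n * S := by
      simp only [← mul_assoc, ← Finset.sum_mul, hinv, if_true]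
      simp [hS, mul_comm]
    simp only [IsMetricOn.sum_mul_christoffelShift
      (fun l ↦ η y (Fin.cons l I : Fin (m + 1) → Fin n)), mul_add, mul_sub,
      Finset.sum_add_distrib, Finset.sum_sub_distrib, h1, h2, h3]
    ring
  -- In each of the `m` other slots, the first term of `S` pairs the symmetric inverse metric with
  -- two alternating slots and vanishes. The other two give `S` each, the third after an exchange of
  -- slots. In total the change is `-((2 - n) + 2m) S = (n - 2(m + 1)) S`, with `S` here the scalar
  -- just introduced.
  have hother : ∀ b, ∑ i, ∑ j, (G y)⁻¹ i j *
      ∑ l, η y (Fin.cons i (Function.update I b l) : Fin (m + 1) → Fin n)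
        * christoffelShift G u y l j (I b) = 2 * S := by
    intro b
    have h1 : ∑ i, ∑ j, (G y)⁻¹ i j *
        (η y (Fin.cons i (Function.update I b j) : Fin (m + 1) → Fin n) * pderiv (I b) u y)
        = 0 := by
      have h : ∑ i, ∑ j, (G y)⁻¹ i j *
          (η y (Fin.cons i (Function.update I b j) : Fin (m + 1) → Fin n) * pderiv (I b) u y) =
          -∑ i, ∑ j, (G y)⁻¹ i j *
          (η y (Fin.cons i (Function.update I b j) : Fin (m + 1) → Fin n)
            * pderiv (I b) u y) := by
        conv_lhs => rw [Finset.sum_comm]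
        simp only [← Finset.sum_neg_distrib]
        refine Finset.sum_congr rfl fun i _ ↦ Finset.sum_congr rfl fun j _ ↦ ?_
        rw [hswap j i, hG.inv_symm hy j i]
        ring
      linarith
    have h2 : ∑ i, ∑ j, (G y)⁻¹ i j *
        (η y (Fin.cons i (Function.update I b (I b)) : Fin (m + 1) → Fin n) * pderiv j u y)
        = S := by
      rw [hS]
      refine Finset.sum_congr rfl fun i _ ↦ ?_
      rw [gradUp, raise, Finset.sum_mul, Function.update_eq_self]
      exact Finset.sum_congr rfl fun j _ ↦ by ring
    have h3 : ∑ i, ∑ j, (G y)⁻¹ i j * (G y j (I b) * ∑ l,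
        η y (Fin.cons i (Function.update I b l) : Fin (m + 1) → Fin n) * gradUp G u y l)
        = -S := by
      simp only [← mul_assoc, ← Finset.sum_mul, hinv, ite_mul, one_mul, zero_mul,
        Finset.sum_ite_eq', Finset.mem_univ, if_true]
      rw [hS, ← Finset.sum_neg_distrib]
      refine Finset.sum_congr rfl fun l _ ↦ ?_
      rw [hswap, Function.update_eq_self]
      ring
    simp only [IsMetricOn.sum_mul_christoffelShift
      (fun l ↦ η y (Fin.cons _ (Function.update I b l) : Fin (m + 1) → Fin n)), mul_add, mul_sub,
      Finset.sum_add_distrib, Finset.sum_sub_distrib, h1, h2, h3]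
    ring
  have hothers : ∑ i, ∑ j, (G y)⁻¹ i j *
      ∑ b, ∑ l, η y (Fin.cons i (Function.update I b l) : Fin (m + 1) → Fin n)
        * christoffelShift G u y l j (I b) = m * (2 * S) := by
    have h : ∑ b : Fin m, (2 * S) = m * (2 * S) := by simp
    rw [← h, ← Finset.sum_congr rfl fun b _ ↦ hother b, Finset.sum_comm]
    rw [Finset.sum_comm (s := Finset.univ (α := Fin m)), Finset.sum_comm]
    refine Finset.sum_congr rfl fun i _ ↦ ?_
    rw [Finset.sum_comm (s := Finset.univ (α := Fin m))]
    exact Finset.sum_congr rfl fun j _ ↦ Finset.mul_sum _ _ _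
  simp only [hcov, hG.rescale_inv hy, Matrix.smul_apply, smul_eq_mul, mul_assoc,
    ← Finset.mul_sum]
  rw [← mul_assoc, hexp, one_mul]
  simp only [mul_sub, mul_add, Finset.sum_sub_distrib, Finset.sum_add_distrib]
  rw [hfirst, hothers]
  ring

end Divergence

/-! ### Invariance of `⋆ρ^Φ` in a chart -/

section LocalInvariance

variable {n k : ℕ}
  {G : EuclideanSpace ℝ (Fin n) → Matrix (Fin n) (Fin n) ℝ}
  {U : Set (EuclideanSpace ℝ (Fin n))} {y : EuclideanSpace ℝ (Fin n)}
  {u : EuclideanSpace ℝ (Fin n) → ℝ} (Φ : InvariantPolynomial n k)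

theorem starP_eq (i : Fin (2 * k) → Fin n) :
    starP G y Φ i = skew (phiTensor Φ (weylRaise4 G y)) i := rfl

theorem weylRaise4_antisymm (i j t s : Fin n) :
    weylRaise4 G y i j t s = -weylRaise4 G y j i t s := by
  simp only [weylRaise4, ← Finset.sum_neg_distrib]
  exact Finset.sum_congr rfl fun m _ ↦ by rw [weyl_antisymm]; ring

namespace IsMetricOn

variable (hG : IsMetricOn G U) (hy : y ∈ U) (hu : ContDiffOn ℝ ∞ u U)
include hG hy hu

theorem starP_rescale (hn : 3 ≤ n) (i : Fin (2 * k) → Fin n) :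
    starP (rescale u G) y Φ i = starP G y Φ i := by
  simp only [starP, hG.weylRaise4_rescale hy hu hn]

omit hu in
theorem covDeriv_congr {H : EuclideanSpace ℝ (Fin n) → Matrix (Fin n) (Fin n) ℝ} {m : ℕ}
    {T T' : EuclideanSpace ℝ (Fin n) → (Fin m → Fin n) → ℝ} (hT : ∀ z ∈ U, T z = T' z)
    (j : Fin n) (i : Fin m → Fin n) : covDeriv H y T j i = covDeriv H y T' j i := by
  rw [covDeriv, covDeriv, hT y hy,
    pderiv_congr hG.isOpen hy fun z hz ↦ congrFun (hT z hz) i]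

/-- Only the Cotton factor changes, and its correction `u^l W_t{}^s{}_{li}` completes the remaining
factors to the unskewed tensor of `⋆p_Φ(W)` with `l` in its first slot. `skew_consIndex` then
matches the two skew symmetrizations. -/
theorem phiWC_rescale (hn : 3 ≤ n) (hk : 1 ≤ k) (I : Fin (2 * k - 1) → Fin n) :
    Real.exp (2 * u y) * phiWC (rescale u G) y Φ I =
      phiWC G y Φ I + ∑ l, gradUp G u y l * starP G y Φ (consIndex l I) := by
  simp only [starP_eq, skew_consIndex hk _
    (exists_isSignInvariant_phiTensor Φ _ hk weylRaise4_antisymm)]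
  simp only [phiWC]
  rw [mul_skew, ← skew_linear]
  congr 1
  funext J
  have hprod : ∀ (x F : Fin k → ℝ), (∏ a : Fin k, if (a : ℕ) = 0 then x a else F a) =
      x ⟨0, hk⟩ * ∏ a ∈ Finset.univ.erase (⟨0, hk⟩ : Fin k), F a := by
    intro x F
    rw [← Finset.mul_prod_erase _ _ (Finset.mem_univ (⟨0, hk⟩ : Fin k)), if_pos rfl]
    congr 1
    refine Finset.prod_congr rfl fun a ha ↦ if_neg fun h ↦ ?_
    exact (Finset.mem_erase.1 ha).1 (Fin.ext h)
  -- Prepending `l` shifts the slots by one: slots `2a` and `2a + 1` of the long tuple are slots `2a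
  -- - 1` and `2a` of `J`, except that slot `0` is `l`.
  have hcons : ∀ l, phiTensor Φ (weylRaise4 G y) (consIndex l J) =
      ∑ s : Fin k → Fin n, ∑ t : Fin k → Fin n, Φ.comp s t *
        ∏ a : Fin k, if (a : ℕ) = 0
          then weylRaise2 G y (t a) (s a) l (J ⟨0, by have := a.isLt; omega⟩)
          else weylRaise2 G y (t a) (s a)
            (J ⟨2 * (a : ℕ) - 1, by omega⟩) (J ⟨2 * (a : ℕ), by omega⟩) := by
    intro l
    refine Finset.sum_congr rfl fun s _ ↦ Finset.sum_congr rfl fun t _ ↦ ?_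
    congr 1
    refine Finset.prod_congr rfl fun a _ ↦ ?_
    rw [hG.weylRaise2_eq_weylRaise4 hy, hG.weylRaise2_eq_weylRaise4 hy]
    by_cases ha : (a : ℕ) = 0
    · simp [consIndex, ha]
    · simp [consIndex, ha]
  simp only [hcons, hprod, hG.weylRaise2_rescale hy hu hn, Finset.mul_sum]
  rw [Finset.sum_comm (s := Finset.univ (α := Fin n)), ← Finset.sum_add_distrib]
  refine Finset.sum_congr rfl fun s _ ↦ ?_
  rw [Finset.sum_comm (s := Finset.univ (α := Fin n)), ← Finset.sum_add_distrib]
  refine Finset.sum_congr rfl fun t _ ↦ ?_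
  rw [mul_left_comm, ← mul_assoc (Real.exp _), hG.cottonRaise2_rescale hy hu hn, add_mul, mul_add,
    Finset.sum_mul, Finset.mul_sum]
  congr 1
  exact Finset.sum_congr rfl fun l _ ↦ by ring

/-- The conformal invariance of `⋆ρ^Φ` in a chart. -/
theorem starRho_rescale (hn : 3 ≤ n) (hk : 1 ≤ k) (hnk : n ≠ 4 * k)
    (I : Fin (2 * k - 1) → Fin n) :
    Real.exp (2 * u y) * starRho (rescale u G) y Φ I = starRho G y Φ I := by
  have hne : (n : ℝ) - 4 * (k : ℝ) ≠ 0 := fun h ↦ hnk (by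
    have : (n : ℝ) = ((4 * k : ℕ) : ℝ) := by push_cast; linarith
    exact_mod_cast this)
  have hdiv : Real.exp (2 * u y) * ∑ i, ∑ j, (rescale u G y)⁻¹ i j *
        covDeriv (rescale u G) y (fun z ↦ starP (rescale u G) z Φ) j (consIndex i I) =
      ∑ i, ∑ j, (G y)⁻¹ i j * covDeriv G y (fun z ↦ starP G z Φ) j (consIndex i I)
        + ((n : ℝ) - 4 * (k : ℝ)) * ∑ l, gradUp G u y l * starP G y Φ (consIndex l I) := by
    -- Invariance of `⋆p_Φ(W)` is used on all of `U`, since the form is differentiated.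
    simp only [hG.covDeriv_congr hy (H := rescale u G)
      (T := fun z ↦ starP (rescale u G) z Φ) (T' := fun z ↦ starP G z Φ)
      (fun z hz ↦ funext fun i ↦ hG.starP_rescale Φ hz hu hn i)]
    obtain ⟨k, rfl⟩ : ∃ k', k = k' + 1 := ⟨k - 1, by omega⟩
    simp only [consIndex_succ]
    have hd := ContDiffOn.differentiableAt_of_isOpen hG.isOpen hu hy
    have h := hG.divergence_rescale (m := 2 * k + 1) hy hd (fun z ↦ starP G z Φ)
      (fun π i ↦ skew_comp _ π i) I
    have hc : (n : ℝ) - 4 * ((k + 1 : ℕ) : ℝ) = (n : ℝ) - 2 * (((2 * k + 1 : ℕ) : ℝ) + 1) := by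
      push_cast
      ring
    rw [hc]
    exact h
  rw [starRho, starRho, mul_sub, hG.phiWC_rescale Φ hy hu hn hk, mul_left_comm, hdiv]
  field_simp
  ring

end IsMetricOn

end LocalInvariance

/-! ### Metric components in a chart of the maximal atlas -/

section Charts

variable {n : ℕ} {M : Type*} [TopologicalSpace M] [ChartedSpace (EuclideanSpace ℝ (Fin n)) M]
  [IsManifold (𝓡 n) ∞ M] {φ : OpenPartialHomeomorph M (EuclideanSpace ℝ (Fin n))}

theorem contMDiffOn_coordinateField (hφ : φ ∈ IsManifold.maximalAtlas (𝓡 n) ∞ M)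
    (e : EuclideanSpace ℝ (Fin n)) :
    ContMDiffOn (𝓡 n) (𝓡 n).tangent ∞
      (fun y ↦ (Bundle.TotalSpace.mk' (EuclideanSpace ℝ (Fin n)) (φ.symm y)
        (mfderiv (𝓡 n) (𝓡 n) φ.symm y e) : TangentBundle (𝓡 n) M)) φ.target := by
  have : IsManifold (𝓡 n) 1 M := IsManifold.of_le (n := ∞) (by simp)
  have h1 := (contMDiffOn_symm_of_mem_maximalAtlas hφ).contMDiffOn_tangentMapWithin
    (m := ∞) (by simp) φ.open_target.uniqueMDiffOn
  have h2 : ContMDiffOn (𝓡 n) (𝓡 n).tangent ∞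
      (fun y ↦ (Bundle.TotalSpace.mk' (EuclideanSpace ℝ (Fin n)) y e :
        TangentBundle (𝓡 n) (EuclideanSpace ℝ (Fin n)))) φ.target :=
    contMDiffOn_vectorSpace_iff_contDiffOn.2 contDiffOn_const
  refine (h1.comp h2 fun y hy ↦ hy).congr fun y hy ↦ ?_
  simp only [Function.comp_apply, tangentMapWithin]
  rw [mfderivWithin_of_isOpen φ.open_target hy]

omit [IsManifold (𝓡 n) ∞ M] in
-- The derivative of `φ` is a left inverse by the chain rule, and an injective endomorphism in
-- finite dimension is surjective.
theorem mfderiv_symm_bijective (hφ : φ ∈ IsManifold.maximalAtlas (𝓡 n) ∞ M)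
    {y : EuclideanSpace ℝ (Fin n)} (hy : y ∈ φ.target) :
    Function.Bijective (mfderiv (𝓡 n) (𝓡 n) φ.symm y) := by
  have h1 : MDifferentiableAt (𝓡 n) (𝓡 n) φ.symm y :=
    (contMDiffAt_symm_of_mem_maximalAtlas hφ hy).mdifferentiableAt (by simp)
  have h2 : MDifferentiableAt (𝓡 n) (𝓡 n) φ (φ.symm y) :=
    (contMDiffAt_of_mem_maximalAtlas hφ (φ.map_target hy)).mdifferentiableAt (by simp)
  have hinj : Function.Injective (mfderiv (𝓡 n) (𝓡 n) φ.symm y) := by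
    have hc := mfderiv_comp y h2 h1
    have hid : mfderiv (𝓡 n) (𝓡 n) (φ ∘ φ.symm) y = ContinuousLinearMap.id ℝ _ := by
      rw [← mfderiv_id]
      refine Filter.EventuallyEq.mfderiv_eq ?_
      exact Filter.eventuallyEq_of_mem (φ.open_target.mem_nhds hy) fun z hz ↦ φ.right_inv hz
    rw [hid] at hc
    intro v w hvw
    have hv := congrArg (fun L ↦ L v) hc
    have hw := congrArg (fun L ↦ L w) hc
    simp only [ContinuousLinearMap.comp_apply] at hv hw
    exact hv.trans ((congrArg _ hvw).trans hw.symm)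
  refine ⟨hinj, ?_⟩
  -- Both tangent spaces unfold to the model space, which makes the derivative an endomorphism.
  let A : EuclideanSpace ℝ (Fin n) →L[ℝ] EuclideanSpace ℝ (Fin n) :=
    mfderiv (𝓡 n) (𝓡 n) φ.symm y
  exact (LinearMap.injective_iff_surjective (f := A.toLinearMap)).1 hinj

theorem PseudoRiemannianMetric.contDiffOn_inChart (g : PseudoRiemannianMetric n M)
    (hφ : φ ∈ IsManifold.maximalAtlas (𝓡 n) ∞ M) (i j : Fin n) :
    ContDiffOn ℝ ∞ (fun y ↦ g.inChart φ y i j) φ.target := by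
  have hb := contMDiffOn_symm_of_mem_maximalAtlas hφ
  have h : ContMDiffOn (𝓡 n) ((𝓡 n).prod 𝓘(ℝ)) ∞
      (fun y ↦ Bundle.TotalSpace.mk' ℝ (E := Bundle.Trivial M ℝ) (φ.symm y)
        (g.val (φ.symm y) (mfderiv (𝓡 n) (𝓡 n) φ.symm y (EuclideanSpace.single i (1 : ℝ)))
          (mfderiv (𝓡 n) (𝓡 n) φ.symm y (EuclideanSpace.single j (1 : ℝ))))) φ.target := by
    apply ContMDiffOn.clm_bundle_apply₂ (F₁ := EuclideanSpace ℝ (Fin n))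
      (F₂ := EuclideanSpace ℝ (Fin n))
    · exact g.contMDiff.comp_contMDiffOn hb
    · exact contMDiffOn_coordinateField hφ _
    · exact contMDiffOn_coordinateField hφ _
  intro y hy
  have hy' := h y hy
  simp only [Bundle.contMDiffWithinAt_totalSpace] at hy'
  exact hy'.2.contDiffWithinAt

/-- A kernel vector of the component matrix gives a tangent vector orthogonal to the whole
coordinate frame, hence zero by nondegeneracy. -/
theorem PseudoRiemannianMetric.det_inChart_ne_zero (g : PseudoRiemannianMetric n M)
    (hφ : φ ∈ IsManifold.maximalAtlas (𝓡 n) ∞ M) {y : EuclideanSpace ℝ (Fin n)}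
    (hy : y ∈ φ.target) : (g.inChart φ y).det ≠ 0 := by
  intro hdet
  obtain ⟨v, hv, hv0⟩ := Matrix.exists_mulVec_eq_zero_iff.2 hdet
  obtain ⟨hinj, hsurj⟩ := mfderiv_symm_bijective hφ hy
  set A : EuclideanSpace ℝ (Fin n) →L[ℝ] TangentSpace (𝓡 n) (φ.symm y) :=
    mfderiv (𝓡 n) (𝓡 n) φ.symm y with hA
  have hexp : ∀ w : EuclideanSpace ℝ (Fin n), w = ∑ j, w j • EuclideanSpace.single j (1 : ℝ) :=
    fun w ↦ by
      ext a
      simp [Finset.sum_apply, Pi.single_apply]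
  have hzero : ∀ i, g.val (φ.symm y) (A (EuclideanSpace.single i (1 : ℝ)))
      (A (WithLp.toLp 2 v)) = 0 := by
    intro i
    have hv0i : (g.inChart φ y).mulVec v i = 0 := congrFun hv0 i
    rw [hexp (WithLp.toLp 2 v), map_sum, map_sum]
    simp only [map_smul, smul_eq_mul]
    rw [← hv0i]
    simp only [Matrix.mulVec, dotProduct]
    exact Finset.sum_congr rfl fun j _ ↦ mul_comm _ _
  have hall : ∀ w, g.val (φ.symm y) (A (WithLp.toLp 2 v)) w = 0 := by
    intro w
    obtain ⟨w, rfl⟩ := hsurj w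
    change g.val (φ.symm y) (A (WithLp.toLp 2 v)) (A w) = 0
    rw [hexp w, map_sum, map_sum]
    refine Finset.sum_eq_zero fun i _ ↦ ?_
    rw [map_smul, map_smul, g.symm, hzero, smul_zero]
  have hAv : A (WithLp.toLp 2 v) = 0 := g.nondegenerate _ _ hall
  have : (WithLp.toLp 2 v : EuclideanSpace ℝ (Fin n)) = 0 :=
    hinj (hAv.trans (map_zero A).symm)
  exact hv (by simpa using this)

theorem PseudoRiemannianMetric.isMetricOn_inChart (g : PseudoRiemannianMetric n M)
    (hφ : φ ∈ IsManifold.maximalAtlas (𝓡 n) ∞ M) : IsMetricOn (g.inChart φ) φ.target where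
  isOpen := φ.open_target
  contDiffOn := g.contDiffOn_inChart hφ
  symm _ _ _ _ := g.symm _ _ _
  det_ne_zero _ hz := g.det_inChart_ne_zero hφ hz

theorem PseudoRiemannianMetric.inChart_conformal (g : PseudoRiemannianMetric n M)
    (Υ : C^∞⟮𝓡 n, M; 𝓘(ℝ), ℝ⟯) :
    (g.conformal Υ).inChart φ = rescale (fun z ↦ Υ (φ.symm z)) (g.inChart φ) := rfl

end Charts

end ConformalForm

/-! ### Invariance on the manifold, componentwise in every chart -/

theorem mainTheorem6 (n k : ℕ) (hn : 3 ≤ n) (hk : 1 ≤ k) (hnk : n ≠ 4 * k)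
    {M : Type*} [TopologicalSpace M] [ChartedSpace (EuclideanSpace ℝ (Fin n)) M]
    [IsManifold (𝓡 n) ∞ M]
    (Φ : ConformalForm.InvariantPolynomial n k)
    (g : ConformalForm.PseudoRiemannianMetric n M)
    (Υ : C^∞⟮𝓡 n, M; 𝓘(ℝ), ℝ⟯)
    (φ : OpenPartialHomeomorph M (EuclideanSpace ℝ (Fin n)))
    (hφ : φ ∈ IsManifold.maximalAtlas (𝓡 n) ∞ M)
    (y : EuclideanSpace ℝ (Fin n)) (hy : y ∈ φ.target)
    (I : Fin (2 * k - 1) → Fin n) :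
    Real.exp (2 * Υ (φ.symm y)) *
        ConformalForm.starRho ((g.conformal Υ).inChart φ) y Φ I =
      ConformalForm.starRho (g.inChart φ) y Φ I := by
  have hu : ContDiffOn ℝ ∞ (fun z ↦ Υ (φ.symm z)) φ.target :=
    (Υ.contMDiff.comp_contMDiffOn (contMDiffOn_symm_of_mem_maximalAtlas hφ)).contDiffOn
  rw [g.inChart_conformal Υ]
  exact (g.isMetricOn_inChart hφ).starRho_rescale Φ hy hu hn hk hnk I
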